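/- Let $SG\subset\mathbb R^2$ be the Sierpinski gasket, with boundary points $q_0,q_1,q_2$ (the vertices of an equilateral triangle), contractions $F_i(x)=\tfrac12(x+q_i)$, $F_w=F_{w_1}\circ\cdots\circ F_{w_n}$ for a word $w=w_1\cdots w_n$, and $V_m=\{F_wq_i:|w|=m,\ i=0,1,2\}$. Let $\mathcal E(u,v)=\lim_{m}\left(\tfrac53\right)^m\sum_{|w|=m}\sum_{i<j}\bigl(u(F_wq_i)-u(F_wq_j)\bigr)\bigl(v(F_wq_i)-v(F_wq_j)\bigr)$ be the standard energy, $\operatorname{dom}\mathcal E$ the continuous functions $u$ with $\mathcal E(u,u)<\infty$, and $\operatorname{dom}_0\mathcal E$ those vanishing on $V_0=\{q_0,q_1,q_2\}$. Let $\zeta$ be a finite Borel measure on $SG$ without atoms and positive on non-empty open sets. Let $\operatorname{dom}_{L^2}\Delta_\zeta$ be the set of $u\in\operatorname{dom}\mathcal E$ for which there is $f\in L^2(\zeta)$ with $\mathcal E(u,v)=-\int fv\,d\zeta$ for all $v\in\operatorname{dom}_0\mathcal E$; then $\Delta_\zeta u:=f$, and $T_\zeta(u):=\int(\Delta_\zeta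 u)^2\,d\zeta=\|\Delta_\zeta u\|_2^2$. Assume that for every word $w$ there is a constant $C_w>0$ such that for all $u\in\operatorname{dom}_{L^2}\Delta_\zeta$ we have $u\circ F_w\in\operatorname{dom}_{L^2}\Delta_\zeta$ and $$\|\Delta_\zeta u\|_2^2\ \ge\ C_w\,\|\Delta_\zeta(u\circ F_w)\|_2^2 .$$ Let $E,F$ be finite subsets of some $V_m$. Assume that there are $x_1,x_2,x_3\in E$ for which the $3\times3$ matrix $\bigl(h_j(x_k)\bigr)_{k,j}$ is invertible, where $h_j$ is the harmonic function (minimizer of $\mathcal E(h,h)$ with given values on $V_0$) with $h_j(q_i)=\delta_{ij}$. For each $y\in F$ fix a word $w$ and an index $i$ (depending on $y$) with $y=F_wq_i$, and let $$\partial_nu(y)=\lim_{k\to\infty}\left(\tfrac53\right)^{|w|+k}\bigl(2u(F_wq_i)-u(F_wF_i^kq_{i+1})-u(F_wF_i^kq_{i-1})\bigr)$$ (indices of $q$ modulo $3$) be the normal derivative at $y$ relative to the cell $F_w(SG)$. Let real numbers $a_x$ $(x\in E)$ and $b_y$ $(y\in F)$ be given, and set $$X=\{u\in\operatorname{dom}_{L^2}\Delta_\zeta:\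 u(x)=a_x\ \text{for all }x\in E,\ \ \partial_nu(y)=b_y\ \text{for all }y\in F\}.$$ Then there is exactly one $u\in X$ with $T_\zeta(u)\le T_\zeta(v)$ for all $v\in X$. -/

import Mathlib

open Filter Topology MeasureTheory

namespace SierpinskiGasket

noncomputable section

/-- The vertices of an equilateral triangle in the plane. -/
def vertex : Fin 3 → EuclideanSpace ℝ (Fin 2) :=
  ![!₂[0, 0], !₂[1, 0], !₂[1 / 2, Real.sqrt 3 / 2]]

/-- The contraction of the plane with ratio `1/2` and fixed point `vertex i`. -/
def contraction (i : Fin 3) (x : EuclideanSpace ℝ (Fin 2)) : EuclideanSpace ℝ (Fin 2) :=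
  (1 / 2 : ℝ) • (x + vertex i)

/-- The point `⋂ m, F_{s 0} ∘ ⋯ ∘ F_{s m} (triangle)` with address `s`. -/
def codingMap (s : ℕ → Fin 3) : EuclideanSpace ℝ (Fin 2) :=
  ∑' k : ℕ, (1 / 2 : ℝ) ^ (k + 1) • vertex (s k)

/-- The Sierpinski gasket, i.e. the attractor of the three contractions (it is nonempty, compact
and equal to the union of its images, see below). -/
def gasket : Set (EuclideanSpace ℝ (Fin 2)) := Set.range codingMap

/-- The Sierpinski gasket as a topological (and Borel) space. -/
abbrev SG : Type := gasket

theorem norm_term_le (v : Fin 3) (k : ℕ) :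
    ‖(1 / 2 : ℝ) ^ (k + 1) • vertex v‖ ≤ (1 / 2 : ℝ) ^ (k + 1) * ∑ j, ‖vertex j‖ := by
  rw [norm_smul, Real.norm_of_nonneg (by positivity)]
  gcongr
  exact Finset.single_le_sum (f := fun j => ‖vertex j‖) (fun j _ => norm_nonneg _)
    (Finset.mem_univ v)

theorem summable_bound :
    Summable fun k : ℕ => (1 / 2 : ℝ) ^ (k + 1) * ∑ j, ‖vertex j‖ :=
  ((summable_nat_add_iff 1).2 (summable_geometric_of_lt_one (by norm_num) (by norm_num))).mul_right _

theorem summable_term (s : ℕ → Fin 3) :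
    Summable fun k : ℕ => (1 / 2 : ℝ) ^ (k + 1) • vertex (s k) :=
  Summable.of_norm_bounded summable_bound fun k => norm_term_le (s k) k

theorem codingMap_eq (s : ℕ → Fin 3) :
    codingMap s = contraction (s 0) (codingMap fun k => s (k + 1)) := by
  unfold codingMap contraction
  rw [(summable_term s).tsum_eq_zero_add, smul_add,
    ← (summable_term fun k => s (k + 1)).tsum_const_smul (1 / 2 : ℝ), add_comm]
  congr 1
  · refine tsum_congr fun k => ?_
    rw [smul_smul, ← pow_succ']
  · simp

theorem contraction_codingMap (i : Fin 3) (s : ℕ → Fin 3) :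
    ∃ t : ℕ → Fin 3, codingMap t = contraction i (codingMap s) :=
  ⟨fun k => if k = 0 then i else s (k - 1), by rw [codingMap_eq]; simp⟩

theorem gasket_eq_iUnion : gasket = ⋃ i, contraction i '' gasket := by
  ext x
  simp only [gasket, Set.mem_iUnion, Set.mem_image, Set.mem_range]
  constructor
  · rintro ⟨s, rfl⟩
    exact ⟨s 0, _, ⟨_, rfl⟩, (codingMap_eq s).symm⟩
  · rintro ⟨i, _, ⟨s, rfl⟩, rfl⟩
    exact contraction_codingMap i s

theorem isCompact_gasket : IsCompact gasket := by
  refine isCompact_range (continuous_tsum (fun k => ?_) summable_bound fun k s => ?_)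
  · have h : Continuous fun s : ℕ → Fin 3 => vertex (s k) :=
      (continuous_of_discreteTopology (f := vertex)).comp
        (continuous_apply (A := fun _ : ℕ => Fin 3) k)
    exact h.const_smul ((1 / 2 : ℝ) ^ (k + 1))
  · exact norm_term_le (s k) k

theorem vertex_mem (i : Fin 3) : vertex i ∈ gasket := by
  refine ⟨fun _ => i, ?_⟩
  have h := codingMap_eq fun _ => i
  simp only [contraction] at h
  have h2 : (2 : ℝ) • codingMap (fun _ => i) = codingMap (fun _ => i) + vertex i := by
    conv_lhs => rw [h]
    rw [smul_smul]
    norm_num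
  rw [two_smul] at h2
  exact add_left_cancel h2

/-- The boundary points `q_0, q_1, q_2` of the gasket. -/
def q (i : Fin 3) : SG := ⟨vertex i, vertex_mem i⟩

/-- The similarity `F_i : SG → SG`, `F_i x = (x + q_i) / 2`. -/
def Fmap (i : Fin 3) (x : SG) : SG :=
  ⟨contraction i x, by
    exact gasket_eq_iUnion.ge (Set.mem_iUnion.2 ⟨i, x.1, x.2, rfl⟩)⟩

/-- For a word `w = w_1 ⋯ w_m`, the map `F_w = F_{w_1} ∘ ⋯ ∘ F_{w_m}`. -/
def Fword : List (Fin 3) → SG → SG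
  | [] => id
  | i :: w => Fmap i ∘ Fword w

/-- The vertices `V_m = {F_w q_i : |w| = m}` of level `m`. -/
def V (m : ℕ) : Set SG := {x | ∃ (w : List (Fin 3)) (i : Fin 3), w.length = m ∧ Fword w (q i) = x}

/-- The energy form of the complete graph on `{q_0, q_1, q_2}`. -/
def energyZero (u v : SG → ℝ) : ℝ :=
  ∑ i : Fin 3, (u (q i) - u (q (i + 1))) * (v (q i) - v (q (i + 1)))

/-- The renormalized graph energy form of level `m`,
`(5/3)^m ∑_{x ~_m y} (u x - u y) (v x - v y)`, the sum being grouped by the `m`-cells. -/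
def energyLevel (m : ℕ) (u v : SG → ℝ) : ℝ :=
  (5 / 3 : ℝ) ^ m *
    ∑ w : Fin m → Fin 3, energyZero (u ∘ Fword (List.ofFn w)) (v ∘ Fword (List.ofFn w))

/-- The domain of the energy: continuous functions whose (nondecreasing) sequence of graph
energies stays bounded. -/
def domE : Set (SG → ℝ) :=
  {u | Continuous u ∧ BddAbove (Set.range fun m => energyLevel m u u)}

/-- The functions of finite energy that vanish on the boundary `V_0`. -/
def domE0 : Set (SG → ℝ) := {u | u ∈ domE ∧ ∀ i, u (q i) = 0}

/-- The energy form `ℰ(u, v) = lim_m ℰ_m(u, v)`; the limit exists for `u, v` in `domE`. -/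
def energy (u v : SG → ℝ) : ℝ := limUnder atTop fun m => energyLevel m u v

/-- Harmonic functions: the minimizers of energy with given values on `V_0`. -/
def IsHarmonic (h : SG → ℝ) : Prop :=
  h ∈ domE ∧ ∀ u ∈ domE, (∀ i, u (q i) = h (q i)) → energy h h ≤ energy u u

/-- `u` has finite energy and `Δ_ζ u = f`, in the weak sense, with `f ∈ L²(ζ)`. -/
def HasLaplacian (ζ : Measure SG) (u : SG → ℝ) (f : Lp ℝ 2 ζ) : Prop :=
  u ∈ domE ∧ ∀ v ∈ domE0, energy u v = -∫ x, f x * v x ∂ζ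

/-- The `L²` domain of the Laplacian `Δ_ζ`. -/
def domLaplacian (ζ : Measure SG) : Set (SG → ℝ) := {u | ∃ f : Lp ℝ 2 ζ, HasLaplacian ζ u f}

open Classical in
/-- The Laplacian `Δ_ζ u ∈ L²(ζ)` of `u ∈ domLaplacian ζ` (and `0` for other `u`). For a finite
measure without atoms it is uniquely determined. -/
def laplacian (ζ : Measure SG) (u : SG → ℝ) : Lp ℝ 2 ζ :=
  if hu : ∃ f : Lp ℝ 2 ζ, HasLaplacian ζ u f then hu.choose else 0

/-- The functional `T_ζ(u) = ∫ (Δ_ζ u)² dζ = ‖Δ_ζ u‖₂²`. -/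
def T (ζ : Measure SG) (u : SG → ℝ) : ℝ := ∫ x, (laplacian ζ u x) ^ 2 ∂ζ

/-- The normal derivative of `u` at the point `F_w q_i`, relative to the cell `F_w SG`, exists and
equals `b`:
`b = lim_k (5/3)^(|w|+k) (2 u(F_w q_i) - u(F_w F_i^k q_{i+1}) - u(F_w F_i^k q_{i-1}))`. -/
def HasNormalDeriv (u : SG → ℝ) (w : List (Fin 3)) (i : Fin 3) (b : ℝ) : Prop :=
  Tendsto (fun k : ℕ => (5 / 3 : ℝ) ^ (w.length + k) *
      (2 * u (Fword w (q i)) - u (Fword w ((Fmap i)^[k] (q (i + 1))))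
        - u (Fword w ((Fmap i)^[k] (q (i - 1))))))
    atTop (𝓝 b)

/-- Among the points of `E` there are three at which the matrix of the values of the harmonic
functions `h_0, h_1, h_2` with `h_j(q_i) = δ_{ij}` is invertible. -/
def HarmonicallyNondegenerate (E : Finset SG) : Prop :=
  ∃ h : Fin 3 → SG → ℝ, (∀ j, IsHarmonic (h j) ∧ ∀ i, h j (q i) = if i = j then 1 else 0) ∧
    ∃ x : Fin 3 → SG, (∀ k, x k ∈ E) ∧ IsUnit (Matrix.of fun k j => h j (x k))

/-- For every word `w` there is `C_w > 0` with `‖Δ_ζ u‖² ≥ C_w ‖Δ_ζ (u ∘ F_w)‖²` for all `u` in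
the `L²` domain of `Δ_ζ` (in particular `u ∘ F_w` is in this domain). -/
def LaplacianCellBound (ζ : Measure SG) : Prop :=
  ∀ w : List (Fin 3), ∃ C : ℝ, 0 < C ∧ ∀ u ∈ domLaplacian ζ,
    u ∘ Fword w ∈ domLaplacian ζ ∧ C * T ζ (u ∘ Fword w) ≤ T ζ u

/-- The functions in the `L²` domain of `Δ_ζ` with value `a x` at each `x ∈ E` and normal
derivative `b y` at each `y ∈ F`, the latter taken relative to the cell `F_{w y} SG`, of which
`y = F_{w y} q_{i y}` is a corner. -/
def admissible (ζ : Measure SG) (E F : Finset SG) (a b : SG → ℝ) (w : SG → List (Fin 3))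
    (i : SG → Fin 3) : Set (SG → ℝ) :=
  {u | u ∈ domLaplacian ζ ∧ (∀ x ∈ E, u x = a x) ∧ ∀ y ∈ F, HasNormalDeriv u (w y) (i y) (b y)}

end

end SierpinskiGasket

open SierpinskiGasket

/-!
A function in the `L²` domain of the Laplacian is `u = H + G f`, where `f = Δ_ζ u`, `G` is the
Green operator (the solution of the Dirichlet problem, by the Riesz representation theorem in the
Hilbert space `EnergySpace` of functions of finite energy vanishing on `V_0`), and `H` is harmonic.
The values of `u` at three nondegenerate points of `E` determine `H` as an affine continuous
function of `f`. So the problem is to minimize `‖f‖` over the set `admissibleLaplacians` of the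
Laplacians of admissible functions, which has exactly one element of least norm if it is non-empty,
closed and convex; and `T ζ u = ‖f‖²`, since the Laplacian is unique (`T_eq_norm_sq`; the functions
of `domE0` are dense in `L²(ζ)` as `ζ` has no atoms).

*Closedness* (`isClosed_admissibleLaplacians`). Point values of `u` depend continuously on `f`. So
do normal derivatives, by the local Gauss-Green formula (`HasLaplacian.hasNormalDeriv`): the normal
derivative at the corner `F_w q_i` of a cell is a combination of the values of `u` at the three
corners plus the integral of `f` against the function that is harmonic on the cell, is `1` at
`F_w q_i` and `0` at the other two corners, and is extended by zero.

*Non-emptiness* (`admissible_nonempty`). All data can be placed on one level `n`. The functions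
just described, for all cells of level `n` and all their corners, are linearly independent in
`L²(ζ)`, because `ζ` charges every non-empty open set and the cells have disjoint open interiors;
so the moments of `f` against them can be prescribed (`exists_moments_eq`). The moments to prescribe
are read off from the Gauss-Green formula for the desired values and normal derivatives on `V_n`.
Compatibility requires that at a vertex outside `V_0` the normal derivatives add up to zero; such a
vertex is a corner of at least two cells (`exists_other_corner`), and the prescription concerns only
one of them. The solution of the Dirichlet problem with this `f` then has the desired values on
`V_n`: its difference to them has graph energy zero.

The energy theory behind this rests on the `1/5`-`2/5` rule. It gives the monotonicity of the graph
energies, the construction of the harmonic functions (`harm`) and of the piecewise harmonic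
functions (`piecewiseHarm`), and the identity of `ℰ(·, v)` with the graph energy on the latter
(`energy_piecewiseHarm`).
-/

namespace SierpinskiGasket

noncomputable section

/-! ### Geometry of the gasket -/

/-- The barycentric coordinates of the plane relative to the triangle `vertex 0, 1, 2`. -/
def bary (i : Fin 3) (x : EuclideanSpace ℝ (Fin 2)) : ℝ :=
  ![1 - x 0 - x 1 / Real.sqrt 3, x 0 - x 1 / Real.sqrt 3, 2 * x 1 / Real.sqrt 3] i

theorem continuous_bary (i : Fin 3) : Continuous (bary i) := by
  unfold bary
  fin_cases i <;> simp <;> fun_prop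

theorem sum_bary (x : EuclideanSpace ℝ (Fin 2)) : ∑ i, bary i x = 1 := by
  simp only [bary, Fin.sum_univ_three, Matrix.cons_val]
  ring

theorem bary_vertex (i j : Fin 3) : bary i (vertex j) = if i = j then 1 else 0 := by
  have h3 : Real.sqrt 3 ≠ 0 := by positivity
  fin_cases i <;> fin_cases j <;> simp [bary, vertex] <;> field_simp <;> norm_num

theorem bary_contraction (i j : Fin 3) (x : EuclideanSpace ℝ (Fin 2)) :
    bary i (contraction j x) = (bary i x + if i = j then 1 else 0) / 2 := by
  rw [← bary_vertex i j]
  fin_cases i <;> simp [bary, contraction] <;> ring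

theorem ext_bary {x y : EuclideanSpace ℝ (Fin 2)} (h : ∀ i, bary i x = bary i y) : x = y := by
  have h3 : Real.sqrt 3 ≠ 0 := by positivity
  have h1 := h 1
  have h2 := h 2
  simp only [bary, Matrix.cons_val] at h1 h2
  have e1 : x 1 = y 1 := by field_simp at h2; linarith
  have e0 : x 0 = y 0 := by rw [e1] at h1; linarith
  ext i
  fin_cases i
  · exact e0
  · exact e1

instance : CompactSpace SG := isCompact_iff_compactSpace.1 isCompact_gasket

instance : Nonempty SG := ⟨q 0⟩

theorem exists_Fmap_eq (x : SG) : ∃ i y, Fmap i y = x := by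
  have hx := gasket_eq_iUnion.le x.2
  simp only [Set.mem_iUnion, Set.mem_image] at hx
  obtain ⟨i, y, hy, hxy⟩ := hx
  exact ⟨i, ⟨y, hy⟩, Subtype.ext hxy⟩

theorem bary_Fmap (i j : Fin 3) (x : SG) :
    bary i (Fmap j x) = (bary i x + if i = j then 1 else 0) / 2 :=
  bary_contraction i j x

theorem bary_q (i j : Fin 3) : bary i (q j) = if i = j then 1 else 0 := bary_vertex i j

/-- At a minimum point `F_j y` of a barycentric coordinate on the gasket the value is at least half
of the value at `y`, hence at least half of the minimum. -/
theorem bary_nonneg (i : Fin 3) (x : SG) : 0 ≤ bary i x := by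
  obtain ⟨z, -, hz⟩ := isCompact_univ.exists_isMinOn (Set.univ_nonempty (α := SG))
    ((continuous_bary i).comp continuous_subtype_val).continuousOn
  have hmin : ∀ y : SG, bary i z ≤ bary i y := fun y => hz (Set.mem_univ y)
  obtain ⟨j, y, rfl⟩ := exists_Fmap_eq z
  have h1 := hmin y
  rw [bary_Fmap] at h1
  have h2 := hmin x
  rw [bary_Fmap] at h2
  split_ifs at h1 h2 <;> linarith

theorem eq_q_of_one_le_bary {i : Fin 3} {x : SG} (h : 1 ≤ bary i x) : x = q i := by
  have hs := sum_bary x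
  have h0 := bary_nonneg 0 x
  have h1 := bary_nonneg 1 x
  have h2 := bary_nonneg 2 x
  rw [Fin.sum_univ_three] at hs
  refine Subtype.ext (ext_bary fun j => ?_)
  rw [bary_q]
  fin_cases i <;> fin_cases j <;> simp at h ⊢ <;> linarith

theorem q_injective : Function.Injective q := by
  intro i j h
  by_contra hne
  have h1 := bary_q i i
  rw [h, bary_q] at h1
  simp [hne] at h1

theorem Fmap_injective (i : Fin 3) : Function.Injective (Fmap i) := by
  intro x y h
  refine Subtype.ext (ext_bary fun j => ?_)
  have h1 := bary_Fmap j i x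
  rw [h, bary_Fmap] at h1
  linarith

/-- Two different cells of level one meet in the common corner only. -/
theorem eq_q_of_Fmap_eq {i j : Fin 3} (hij : i ≠ j) {x y : SG} (h : Fmap i x = Fmap j y) :
    x = q j ∧ y = q i := by
  constructor
  · apply eq_q_of_one_le_bary
    have h1 := bary_Fmap j i x
    rw [h, bary_Fmap, if_pos rfl, if_neg hij.symm] at h1
    linarith [bary_nonneg j y]
  · apply eq_q_of_one_le_bary
    have h1 := bary_Fmap i j y
    rw [← h, bary_Fmap, if_pos rfl, if_neg hij] at h1
    linarith [bary_nonneg i x]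

theorem Fmap_q_comm (i j : Fin 3) : Fmap i (q j) = Fmap j (q i) := by
  refine Subtype.ext (ext_bary fun k => ?_)
  rw [bary_Fmap, bary_Fmap, bary_q, bary_q, add_comm]

theorem Fmap_q_self (i : Fin 3) : Fmap i (q i) = q i := by
  refine Subtype.ext (ext_bary fun k => ?_)
  rw [bary_Fmap, bary_q]
  ring

theorem bary_le_one (i : Fin 3) (x : SG) : bary i x ≤ 1 := by
  rw [← sum_bary x]
  exact Finset.single_le_sum (f := fun j => bary j x) (fun j _ => bary_nonneg j x)
    (Finset.mem_univ i)

theorem eq_q_of_Fmap_eq_q {i j : Fin 3} {x : SG} (h : Fmap i x = q j) : i = j ∧ x = q j := by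
  have h1 := bary_Fmap j i x
  rw [h, bary_q, if_pos rfl] at h1
  have h2 := bary_le_one j x
  have hji : j = i := by
    by_contra hne
    rw [if_neg hne] at h1
    linarith
  rw [if_pos hji] at h1
  exact ⟨hji.symm, eq_q_of_one_le_bary (by linarith)⟩

theorem dist_Fmap (i : Fin 3) (x y : SG) : dist (Fmap i x) (Fmap i y) = dist x y / 2 := by
  have : (Fmap i x).1 - (Fmap i y).1 = (1 / 2 : ℝ) • (x.1 - y.1) := by
    simp only [Fmap, contraction]
    rw [← smul_sub, add_sub_add_right_eq_sub]
  rw [Subtype.dist_eq, Subtype.dist_eq, dist_eq_norm, this, norm_smul, dist_eq_norm]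
  norm_num
  ring

theorem continuous_Fmap (i : Fin 3) : Continuous (Fmap i) := by
  unfold Fmap contraction
  fun_prop

theorem Fword_append (w w' : List (Fin 3)) : Fword (w ++ w') = Fword w ∘ Fword w' := by
  induction w with
  | nil => rfl
  | cons i w ih => simp only [List.cons_append, Fword, ih, Function.comp_assoc]

theorem Fword_replicate (n : ℕ) (i : Fin 3) : Fword (List.replicate n i) = (Fmap i)^[n] := by
  induction n with
  | zero => rfl
  | succ n ih => rw [List.replicate_succ, Fword, ih, Function.iterate_succ']

theorem Fword_replicate_q (n : ℕ) (i : Fin 3) : Fword (List.replicate n i) (q i) = q i := by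
  rw [Fword_replicate]
  exact Function.iterate_fixed (Fmap_q_self i) n

theorem Fword_injective (w : List (Fin 3)) : Function.Injective (Fword w) := by
  induction w with
  | nil => exact Function.injective_id
  | cons i w ih => exact (Fmap_injective i).comp ih

theorem continuous_Fword (w : List (Fin 3)) : Continuous (Fword w) := by
  induction w with
  | nil => exact continuous_id
  | cons i w ih => exact (continuous_Fmap i).comp ih

theorem isClosedEmbedding_Fword (w : List (Fin 3)) : IsClosedEmbedding (Fword w) :=
  (continuous_Fword w).isClosedEmbedding (Fword_injective w)

theorem dist_Fword (w : List (Fin 3)) (x y : SG) :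
    dist (Fword w x) (Fword w y) = (1 / 2) ^ w.length * dist x y := by
  induction w with
  | nil => simp [Fword]
  | cons i w ih =>
    simp only [Fword, Function.comp, dist_Fmap, ih, List.length_cons, pow_succ]
    ring

theorem exists_Fword_eq (n : ℕ) (x : SG) :
    ∃ (w : List (Fin 3)) (y : SG), w.length = n ∧ Fword w y = x := by
  induction n generalizing x with
  | zero => exact ⟨[], x, rfl, rfl⟩
  | succ n ih =>
    obtain ⟨i, y, rfl⟩ := exists_Fmap_eq x
    obtain ⟨w, z, hw, rfl⟩ := ih y
    exact ⟨i :: w, z, by simp [hw], rfl⟩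

/-- Points of one cell of level `n` are uniformly close to each other when `n` is large. -/
theorem eventually_dist_Fword_lt {ε : ℝ} (hε : 0 < ε) :
    ∀ᶠ n : ℕ in atTop, ∀ (w : List (Fin 3)) (x y : SG), w.length = n →
      dist (Fword w x) (Fword w y) < ε := by
  have h : Tendsto (fun n : ℕ => (1 / 2 : ℝ) ^ n * Metric.diam (Set.univ : Set SG)) atTop
      (𝓝 0) := by
    simpa using (tendsto_pow_atTop_nhds_zero_of_lt_one (r := (1 / 2 : ℝ)) (by norm_num)
      (by norm_num)).mul_const (Metric.diam (Set.univ : Set SG))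
  filter_upwards [h.eventually_lt_const hε] with n hn w x y hw
  rw [dist_Fword, hw]
  refine lt_of_le_of_lt ?_ hn
  gcongr
  exact Metric.dist_le_diam_of_mem isCompact_univ.isBounded (Set.mem_univ x) (Set.mem_univ y)

theorem V_mono {m n : ℕ} (h : m ≤ n) : V m ⊆ V n := by
  rintro x ⟨w, i, hw, rfl⟩
  refine ⟨w ++ List.replicate (n - m) i, i, by simp [hw, h], ?_⟩
  rw [Fword_append, Function.comp, Fword_replicate_q]

theorem finite_V (m : ℕ) : (V m).Finite := by
  have : V m ⊆ Set.range fun p : (Fin m → Fin 3) × Fin 3 => Fword (List.ofFn p.1) (q p.2) := by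
    rintro x ⟨w, i, rfl, rfl⟩
    exact ⟨(w.get, i), by simp⟩
  exact (Set.finite_range _).subset this

theorem q_mem_V (m : ℕ) (i : Fin 3) : q i ∈ V m :=
  V_mono (Nat.zero_le m) ⟨[], i, rfl, rfl⟩

theorem mem_V_zero {x : SG} : x ∈ V 0 ↔ ∃ i, x = q i := by
  constructor
  · rintro ⟨w, i, hw, rfl⟩
    rw [List.length_eq_zero_iff] at hw
    exact ⟨i, by rw [hw]; rfl⟩
  · rintro ⟨i, rfl⟩
    exact q_mem_V 0 i

theorem Fword_eq_q {w : List (Fin 3)} {x : SG} {j : Fin 3} (h : Fword w x = q j) : x = q j := by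
  induction w with
  | nil => exact h
  | cons i w ih => exact ih (eq_q_of_Fmap_eq_q h).2

/-- Two points of different cells of the same level coincide only if they are corners. -/
theorem mem_V_zero_of_Fword_eq {w w' : List (Fin 3)} (hl : w.length = w'.length) (hne : w ≠ w')
    {x y : SG} (h : Fword w x = Fword w' y) : x ∈ V 0 := by
  induction w generalizing w' with
  | nil => exact absurd (List.length_eq_zero_iff.1 hl.symm).symm hne
  | cons i w ih =>
    cases w' with
    | nil => simp at hl
    | cons j w' =>
      by_cases hij : i = j
      · subst hij
        exact ih (by simpa using hl) (fun h => hne (by rw [h])) (Fmap_injective i h)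
      · exact mem_V_zero.2 ⟨j, Fword_eq_q (eq_q_of_Fmap_eq hij h).1⟩

theorem isOpen_image_Fmap (i : Fin 3) {U : Set SG} (hU : IsOpen U) (hU0 : Disjoint U (V 0)) :
    IsOpen (Fmap i '' U) := by
  have h : (Fmap i '' U)ᶜ = Fmap i '' Uᶜ ∪ ⋃ j ∈ ({i}ᶜ : Set (Fin 3)), Set.range (Fmap j) := by
    ext x
    simp only [Set.mem_compl_iff, Set.mem_union, Set.mem_iUnion, Set.mem_singleton_iff, exists_prop]
    constructor
    · intro hx
      obtain ⟨j, y, rfl⟩ := exists_Fmap_eq x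
      by_cases hj : j = i
      · subst hj
        exact Or.inl ⟨y, fun hy => hx ⟨y, hy, rfl⟩, rfl⟩
      · exact Or.inr ⟨j, hj, y, rfl⟩
    · rintro (⟨y, hy, rfl⟩ | ⟨j, hj, y, rfl⟩) ⟨z, hz, hzy⟩
      · exact hy (Fmap_injective i hzy ▸ hz)
      · exact Set.disjoint_left.1 hU0 hz
          (mem_V_zero.2 ⟨j, (eq_q_of_Fmap_eq (Ne.symm hj) hzy).1⟩)
  rw [← isClosed_compl_iff, h]
  refine IsClosed.union ?_ (Set.Finite.isClosed_biUnion (Set.toFinite _) fun j _ => ?_)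
  · exact (hU.isClosed_compl.isCompact.image (continuous_Fmap i)).isClosed
  · exact (isCompact_range (continuous_Fmap j)).isClosed

/-- Cell maps are open away from the boundary. -/
theorem isOpen_image_Fword (w : List (Fin 3)) {U : Set SG} (hU : IsOpen U)
    (hU0 : Disjoint U (V 0)) : IsOpen (Fword w '' U) ∧ Disjoint (Fword w '' U) (V 0) := by
  have hdisj : Disjoint (Fword w '' U) (V 0) := by
    rw [Set.disjoint_left]
    rintro _ ⟨x, hx, rfl⟩ h
    obtain ⟨j, hj⟩ := mem_V_zero.1 h
    exact Set.disjoint_left.1 hU0 hx (mem_V_zero.2 ⟨j, Fword_eq_q hj⟩)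
  refine ⟨?_, hdisj⟩
  clear hdisj
  induction w with
  | nil => simpa [Fword] using hU
  | cons i w ih =>
    rw [Fword, Set.image_comp]
    refine isOpen_image_Fmap i ih ?_
    rw [Set.disjoint_left]
    rintro _ ⟨x, hx, rfl⟩ h
    obtain ⟨j, hj⟩ := mem_V_zero.1 h
    exact Set.disjoint_left.1 hU0 hx (mem_V_zero.2 ⟨j, Fword_eq_q hj⟩)

/-- A vertex `F_w q_i` outside `V_0` is a corner of a second cell of the same level. -/
theorem exists_other_corner (w : List (Fin 3)) (i : Fin 3) (h : Fword w (q i) ∉ V 0) :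
    ∃ (w' : List (Fin 3)) (i' : Fin 3), w'.length = w.length ∧ (w', i') ≠ (w, i) ∧
      Fword w' (q i') = Fword w (q i) := by
  induction w with
  | nil => exact absurd (mem_V_zero.2 ⟨i, rfl⟩) h
  | cons j w ih =>
    by_cases hw : Fword w (q i) ∈ V 0
    · obtain ⟨k, hk⟩ := mem_V_zero.1 hw
      have hik : i = k := q_injective (Fword_eq_q hk)
      subst hik
      have hij : i ≠ j := by
        rintro rfl
        refine h (mem_V_zero.2 ⟨i, ?_⟩)
        simp only [Fword, Function.comp, hk, Fmap_q_self]
      refine ⟨i :: List.replicate w.length j, j, by simp, by simp [hij], ?_⟩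
      simp only [Fword, Function.comp, hk, Fword_replicate_q]
      exact Fmap_q_comm i j
    · obtain ⟨w', i', hl, hne, he⟩ := ih hw
      refine ⟨j :: w', i', by simp [hl], ?_, by simp only [Fword, Function.comp, he]⟩
      simpa using hne

theorem isQuotientMap_Fmap : IsQuotientMap fun p : Fin 3 × SG => Fmap p.1 p.2 := by
  have hc : Continuous fun p : Fin 3 × SG => Fmap p.1 p.2 :=
    continuous_prod_of_discrete_left.2 fun i => continuous_Fmap i
  refine hc.isClosedMap.isQuotientMap hc fun x => ?_
  obtain ⟨i, y, h⟩ := exists_Fmap_eq x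
  exact ⟨(i, y), h⟩

/-- The function that is given by `g i` on the cell `F_i SG`. The `g i` are assumed to agree at the
common corners of the cells whenever this is used. -/
def glue (g : Fin 3 → SG → ℝ) (x : SG) : ℝ :=
  g (Function.surjInv isQuotientMap_Fmap.surjective x).1
    (Function.surjInv isQuotientMap_Fmap.surjective x).2

theorem glue_comp {g : Fin 3 → SG → ℝ} (hg : ∀ i j, g i (q j) = g j (q i)) (i : Fin 3) :
    glue g ∘ Fmap i = g i := by
  funext x
  have h := Function.surjInv_eq isQuotientMap_Fmap.surjective (Fmap i x)
  simp only [glue, Function.comp]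
  generalize Function.surjInv isQuotientMap_Fmap.surjective (Fmap i x) = p at h
  obtain ⟨j, y⟩ := p
  simp only at h ⊢
  by_cases hij : j = i
  · subst hij
    rw [Fmap_injective j h]
  · obtain ⟨rfl, rfl⟩ := eq_q_of_Fmap_eq hij h
    exact hg j i

theorem continuous_of_comp_Fmap {u : SG → ℝ} (hu : ∀ i, Continuous (u ∘ Fmap i)) :
    Continuous u :=
  isQuotientMap_Fmap.continuous_iff.2 (continuous_prod_of_discrete_left.2 hu)

theorem glue_q {g : Fin 3 → SG → ℝ} (hg : ∀ i j, g i (q j) = g j (q i)) (i : Fin 3) :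
    glue g (q i) = g i (q i) := by
  conv_lhs => rw [← Fmap_q_self i]
  exact congrFun (glue_comp hg i) (q i)

/-! ### The energy form -/

theorem energyZero_eq (u v : SG → ℝ) :
    energyZero u v = (u (q 0) - u (q 1)) * (v (q 0) - v (q 1)) +
      (u (q 1) - u (q 2)) * (v (q 1) - v (q 2)) + (u (q 2) - u (q 0)) * (v (q 2) - v (q 0)) := by
  simp [energyZero, Fin.sum_univ_three]

theorem energyLevel_zero (u v : SG → ℝ) : energyLevel 0 u v = energyZero u v := by
  simp [energyLevel, Fword]

/-- Self-similarity of the graph energies. -/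
theorem energyLevel_succ (m : ℕ) (u v : SG → ℝ) :
    energyLevel (m + 1) u v = 5 / 3 * ∑ i, energyLevel m (u ∘ Fmap i) (v ∘ Fmap i) := by
  simp only [energyLevel]
  rw [← (Fin.consEquiv fun _ : Fin (m + 1) => Fin 3).sum_comp, Fintype.sum_prod_type,
    Finset.mul_sum, Finset.mul_sum]
  refine Finset.sum_congr rfl fun i _ => ?_
  rw [pow_succ', mul_assoc]
  simp [Fin.consEquiv, List.ofFn_succ, Fword, Function.comp_assoc]

theorem energyLevel_comm (m : ℕ) (u v : SG → ℝ) : energyLevel m u v = energyLevel m v u := by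
  simp only [energyLevel, energyZero]
  simp_rw [mul_comm]

theorem energyLevel_add_left (m : ℕ) (u u' v : SG → ℝ) :
    energyLevel m (u + u') v = energyLevel m u v + energyLevel m u' v := by
  simp only [energyLevel, energyZero, ← mul_add, ← Finset.sum_add_distrib]
  refine congrArg _ (Finset.sum_congr rfl fun w _ => Finset.sum_congr rfl fun i _ => ?_)
  simp only [Function.comp, Pi.add_apply]
  ring

theorem energyLevel_smul_left (m : ℕ) (c : ℝ) (u v : SG → ℝ) :
    energyLevel m (c • u) v = c * energyLevel m u v := by
  simp only [energyLevel, energyZero, Finset.mul_sum]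
  refine Finset.sum_congr rfl fun w _ => Finset.sum_congr rfl fun i _ => ?_
  simp only [Function.comp, Pi.smul_apply, smul_eq_mul]
  ring

theorem energyLevel_self_nonneg (m : ℕ) (u : SG → ℝ) : 0 ≤ energyLevel m u u := by
  unfold energyLevel energyZero
  exact mul_nonneg (by positivity) (Finset.sum_nonneg fun w _ => Finset.sum_nonneg fun i _ =>
    mul_self_nonneg _)

theorem energyLevel_add_self (m : ℕ) (u v : SG → ℝ) : energyLevel m (u + v) (u + v) =
    energyLevel m u u + 2 * energyLevel m u v + energyLevel m v v := by
  rw [energyLevel_add_left, energyLevel_comm m u, energyLevel_comm m v, energyLevel_add_left,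
    energyLevel_add_left, energyLevel_comm m v u]
  ring

theorem energyLevel_smul_self (m : ℕ) (c : ℝ) (u : SG → ℝ) :
    energyLevel m (c • u) (c • u) = c ^ 2 * energyLevel m u u := by
  rw [energyLevel_smul_left, energyLevel_comm, energyLevel_smul_left]
  ring

/-- The difference of the two sides is `5/3` times a sum of squares in the deviations of `u` at
the midpoints from the harmonic values given by the `1/5`-`2/5` rule. -/
theorem energyZero_le_energyLevel_one (u : SG → ℝ) : energyZero u u ≤ energyLevel 1 u u := by
  rw [energyLevel_succ]
  simp only [energyLevel_zero, energyZero_eq, Fin.sum_univ_three, Function.comp, Fmap_q_self,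
    Fmap_q_comm 1 0, Fmap_q_comm 2 0, Fmap_q_comm 2 1]
  generalize u (q 0) = a
  generalize u (q 1) = b
  generalize u (q 2) = c
  generalize u (Fmap 0 (q 1)) = x
  generalize u (Fmap 0 (q 2)) = y
  generalize u (Fmap 1 (q 2)) = z
  have hx : 0 ≤ (x - (2 * a + 2 * b + c) / 5) ^ 2 := sq_nonneg _
  have hy : 0 ≤ (y - (2 * a + 2 * c + b) / 5) ^ 2 := sq_nonneg _
  have hz : 0 ≤ (z - (2 * b + 2 * c + a) / 5) ^ 2 := sq_nonneg _
  have hxy : 0 ≤ ((x - (2 * a + 2 * b + c) / 5) - (y - (2 * a + 2 * c + b) / 5)) ^ 2 := sq_nonneg _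
  have hxz : 0 ≤ ((x - (2 * a + 2 * b + c) / 5) - (z - (2 * b + 2 * c + a) / 5)) ^ 2 := sq_nonneg _
  have hyz : 0 ≤ ((y - (2 * a + 2 * c + b) / 5) - (z - (2 * b + 2 * c + a) / 5)) ^ 2 := sq_nonneg _
  linear_combination 5 / 3 * (2 * hx + 2 * hy + 2 * hz + hxy + hxz + hyz)

theorem energyLevel_le_succ (m : ℕ) (u : SG → ℝ) :
    energyLevel m u u ≤ energyLevel (m + 1) u u := by
  induction m generalizing u with
  | zero => rw [energyLevel_zero]; exact energyZero_le_energyLevel_one u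
  | succ m ih =>
    rw [energyLevel_succ, energyLevel_succ (m + 1)]
    gcongr with i
    exact ih _

theorem monotone_energyLevel (u : SG → ℝ) : Monotone fun m => energyLevel m u u :=
  monotone_nat_of_le_succ fun m => energyLevel_le_succ m u

theorem mem_domE_of_le {u : SG → ℝ} (hc : Continuous u) {C : ℝ}
    (h : ∀ m, energyLevel m u u ≤ C) : u ∈ domE :=
  ⟨hc, C, by rintro _ ⟨m, rfl⟩; exact h m⟩

theorem add_mem_domE {u v : SG → ℝ} (hu : u ∈ domE) (hv : v ∈ domE) : u + v ∈ domE := by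
  obtain ⟨hu, A, hA⟩ := hu
  obtain ⟨hv, B, hB⟩ := hv
  refine mem_domE_of_le (hu.add hv) (C := 2 * A + 2 * B) fun m => ?_
  have h1 := hA ⟨m, rfl⟩
  have h2 := hB ⟨m, rfl⟩
  have h3 := energyLevel_self_nonneg m (u + (-1 : ℝ) • v)
  rw [energyLevel_add_self, energyLevel_smul_self, energyLevel_comm m u (_ • v),
    energyLevel_smul_left, energyLevel_comm m v u] at h3
  rw [energyLevel_add_self]
  simp only at h1 h2
  linarith

theorem smul_mem_domE (c : ℝ) {u : SG → ℝ} (hu : u ∈ domE) : c • u ∈ domE := by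
  obtain ⟨hu, A, hA⟩ := hu
  refine mem_domE_of_le (hu.const_smul c) (C := c ^ 2 * A) fun m => ?_
  rw [energyLevel_smul_self]
  gcongr
  exact hA ⟨m, rfl⟩

theorem sub_mem_domE {u v : SG → ℝ} (hu : u ∈ domE) (hv : v ∈ domE) : u - v ∈ domE := by
  rw [sub_eq_add_neg, ← neg_one_smul ℝ v]
  exact add_mem_domE hu (smul_mem_domE _ hv)

theorem tendsto_energyLevel_self {u : SG → ℝ} (hu : u ∈ domE) :
    Tendsto (fun m => energyLevel m u u) atTop (𝓝 (energy u u)) :=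
  tendsto_nhds_limUnder ⟨_, tendsto_atTop_ciSup (monotone_energyLevel u) hu.2⟩

theorem tendsto_energyLevel {u v : SG → ℝ} (hu : u ∈ domE) (hv : v ∈ domE) :
    Tendsto (fun m => energyLevel m u v) atTop (𝓝 (energy u v)) := by
  refine tendsto_nhds_limUnder ⟨(energy (u + v) (u + v) - energy u u - energy v v) / 2, ?_⟩
  refine ((((tendsto_energyLevel_self (add_mem_domE hu hv)).sub
    (tendsto_energyLevel_self hu)).sub (tendsto_energyLevel_self hv)).div_const 2).congr
    fun m => ?_
  rw [energyLevel_add_self]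
  ring

theorem energyLevel_le_energy {u : SG → ℝ} (hu : u ∈ domE) (m : ℕ) :
    energyLevel m u u ≤ energy u u :=
  (monotone_energyLevel u).ge_of_tendsto (tendsto_energyLevel_self hu) m

theorem energy_self_nonneg {u : SG → ℝ} (hu : u ∈ domE) : 0 ≤ energy u u :=
  (energyLevel_self_nonneg 0 u).trans (energyLevel_le_energy hu 0)

theorem energy_comm (u v : SG → ℝ) : energy u v = energy v u := by
  simp only [energy, energyLevel_comm _ u v]

theorem energy_add_left {u u' v : SG → ℝ} (hu : u ∈ domE) (hu' : u' ∈ domE) (hv : v ∈ domE) :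
    energy (u + u') v = energy u v + energy u' v :=
  tendsto_nhds_unique (tendsto_energyLevel (add_mem_domE hu hu') hv)
    (((tendsto_energyLevel hu hv).add (tendsto_energyLevel hu' hv)).congr fun m =>
      (energyLevel_add_left m u u' v).symm)

theorem energy_smul_left (c : ℝ) {u v : SG → ℝ} (hu : u ∈ domE) (hv : v ∈ domE) :
    energy (c • u) v = c * energy u v :=
  tendsto_nhds_unique (tendsto_energyLevel (smul_mem_domE c hu) hv)
    (((tendsto_energyLevel hu hv).const_mul c).congr fun m =>
      (energyLevel_smul_left m c u v).symm)

theorem energy_sub_left {u u' v : SG → ℝ} (hu : u ∈ domE) (hu' : u' ∈ domE) (hv : v ∈ domE) :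
    energy (u - u') v = energy u v - energy u' v := by
  rw [sub_eq_add_neg, ← neg_one_smul ℝ u', energy_add_left hu (smul_mem_domE _ hu') hv,
    energy_smul_left _ hu' hv]
  ring

theorem energy_sub_right {u v v' : SG → ℝ} (hu : u ∈ domE) (hv : v ∈ domE) (hv' : v' ∈ domE) :
    energy u (v - v') = energy u v - energy u v' := by
  rw [energy_comm, energy_sub_left hv hv' hu, energy_comm v, energy_comm v']

theorem comp_Fmap_mem_domE {u : SG → ℝ} (hu : u ∈ domE) (i : Fin 3) : u ∘ Fmap i ∈ domE := by
  refine mem_domE_of_le (hu.1.comp (continuous_Fmap i)) (C := 3 / 5 * energy u u) fun m => ?_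
  have h := energyLevel_le_energy hu (m + 1)
  rw [energyLevel_succ] at h
  have h2 : energyLevel m (u ∘ Fmap i) (u ∘ Fmap i) ≤
      ∑ i, energyLevel m (u ∘ Fmap i) (u ∘ Fmap i) :=
    Finset.single_le_sum (f := fun i => energyLevel m (u ∘ Fmap i) (u ∘ Fmap i))
      (fun j _ => energyLevel_self_nonneg m _) (Finset.mem_univ i)
  linarith

theorem mem_domE_of_comp_Fmap {u : SG → ℝ} (hu : ∀ i, u ∘ Fmap i ∈ domE) : u ∈ domE := by
  refine mem_domE_of_le (continuous_of_comp_Fmap fun i => (hu i).1)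
    (C := 5 / 3 * ∑ i, energy (u ∘ Fmap i) (u ∘ Fmap i)) fun m => ?_
  refine (energyLevel_le_succ m u).trans ?_
  rw [energyLevel_succ]
  gcongr with i
  exact energyLevel_le_energy (hu i) m

theorem comp_Fword_mem_domE {u : SG → ℝ} (hu : u ∈ domE) (w : List (Fin 3)) :
    u ∘ Fword w ∈ domE := by
  induction w generalizing u with
  | nil => exact hu
  | cons i w ih => exact ih (comp_Fmap_mem_domE hu i)

theorem energy_eq_sum {u v : SG → ℝ} (hu : u ∈ domE) (hv : v ∈ domE) :
    energy u v = 5 / 3 * ∑ i, energy (u ∘ Fmap i) (v ∘ Fmap i) := by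
  refine tendsto_nhds_unique ((tendsto_add_atTop_iff_nat 1).2 (tendsto_energyLevel hu hv)) ?_
  simp only [energyLevel_succ]
  exact (tendsto_finsetSum _ fun i _ => tendsto_energyLevel (comp_Fmap_mem_domE hu i)
    (comp_Fmap_mem_domE hv i)).const_mul _

theorem dense_vertices : Dense (⋃ n, V n) := by
  refine Metric.dense_iff.2 fun x ε hε => ?_
  obtain ⟨n, hn⟩ := (eventually_dist_Fword_lt hε).exists
  obtain ⟨w, y, hw, rfl⟩ := exists_Fword_eq n x
  exact ⟨Fword w (q 0), hn w _ _ hw, Set.mem_iUnion.2 ⟨n, w, 0, hw, rfl⟩⟩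

theorem abs_sub_le_of_energyZero_le {u : SG → ℝ} {e : ℝ} (he : 0 ≤ e) (h : energyZero u u ≤ e ^ 2)
    (i : Fin 3) : |u (q i) - u (q 0)| ≤ e := by
  refine abs_le_of_sq_le_sq ?_ he
  rw [energyZero_eq] at h
  fin_cases i <;> simp <;>
    nlinarith [sq_nonneg (u (q 0) - u (q 1)), sq_nonneg (u (q 1) - u (q 2)),
      sq_nonneg (u (q 2) - u (q 0))]

/-- The energy controls the oscillation. On the vertices of level `n` this goes by induction on
`n`: passing to a cell of level one multiplies the bound `e` of the square root of the energy by
`√(3/5) ≤ 4/5`, and `5 = 1 + 4/5 * 5`. -/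
theorem abs_sub_le_of_energyLevel_le {u : SG → ℝ} (hu : Continuous u) {e : ℝ} (he : 0 ≤ e)
    (h : ∀ m, energyLevel m u u ≤ e ^ 2) (x : SG) : |u x - u (q 0)| ≤ 5 * e := by
  have key : ∀ (n : ℕ) (u : SG → ℝ) (e : ℝ), 0 ≤ e → (∀ m, energyLevel m u u ≤ e ^ 2) →
      ∀ x ∈ V n, |u x - u (q 0)| ≤ 5 * e := by
    intro n
    induction n with
    | zero =>
      intro u e he h x hx
      obtain ⟨i, rfl⟩ := mem_V_zero.1 hx
      have := abs_sub_le_of_energyZero_le he ((energyLevel_zero u u).symm.trans_le (h 0)) i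
      linarith
    | succ n ih =>
      rintro u e he h x ⟨w, j, hw, rfl⟩
      obtain ⟨i, w, rfl⟩ := List.exists_cons_of_length_eq_add_one hw
      have hcell : ∀ (i : Fin 3) m,
          energyLevel m (u ∘ Fmap i) (u ∘ Fmap i) ≤ (4 / 5 * e) ^ 2 := by
        intro i m
        have h1 := h (m + 1)
        rw [energyLevel_succ] at h1
        have h2 : energyLevel m (u ∘ Fmap i) (u ∘ Fmap i) ≤
            ∑ i, energyLevel m (u ∘ Fmap i) (u ∘ Fmap i) :=
          Finset.single_le_sum (f := fun i => energyLevel m (u ∘ Fmap i) (u ∘ Fmap i))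
            (fun j _ => energyLevel_self_nonneg m _) (Finset.mem_univ i)
        nlinarith [sq_nonneg e]
      have h1 := ih (u ∘ Fmap i) (4 / 5 * e) (by positivity) (hcell i) (Fword w (q j))
        ⟨w, j, by simpa using hw, rfl⟩
      have h2 := abs_sub_le_of_energyZero_le (u := u ∘ Fmap 0) (e := 4 / 5 * e) (by positivity)
        ((energyLevel_zero _ _).symm.trans_le (hcell 0 0)) i
      simp only [Function.comp, Fmap_q_self, Fmap_q_comm 0 i] at h1 h2
      have h3 := abs_sub_le (u (Fmap i (Fword w (q j)))) (u (Fmap i (q 0))) (u (q 0))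
      simp only [Fword, Function.comp]
      linarith
  have hcl : IsClosed {x | |u x - u (q 0)| ≤ 5 * e} :=
    isClosed_le (by fun_prop) continuous_const
  have hsub : (⋃ n, V n) ⊆ {x | |u x - u (q 0)| ≤ 5 * e} :=
    Set.iUnion_subset fun n x hx => key n u e he h x hx
  exact hcl.closure_subset_iff.2 hsub (dense_vertices x)

theorem abs_sub_le_energy {u : SG → ℝ} (hu : u ∈ domE) (x : SG) :
    |u x - u (q 0)| ≤ 5 * Real.sqrt (energy u u) :=
  abs_sub_le_of_energyLevel_le hu.1 (Real.sqrt_nonneg _)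
    (fun m => by rw [Real.sq_sqrt (energy_self_nonneg hu)]; exact energyLevel_le_energy hu m) x

theorem eq_zero_of_energy_eq_zero {u : SG → ℝ} (hu : u ∈ domE0) (h : energy u u = 0) : u = 0 := by
  funext x
  have := abs_sub_le_energy hu.1 x
  rw [h, hu.2 0, Real.sqrt_zero, sub_zero, mul_zero] at this
  exact abs_nonpos_iff.1 this

/-! ### Harmonic and piecewise harmonic functions -/

/-- The `1/5`-`2/5` rule: the values at the corners `F_i q_j` of the cell `F_i SG` of the harmonic
function with boundary values `a`. -/
def harmStep (i : Fin 3) (a : Fin 3 → ℝ) (j : Fin 3) : ℝ :=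
  if j = i then a i else (a i + a j + ∑ k, a k) / 5

theorem harmStep_self (i : Fin 3) (a : Fin 3 → ℝ) : harmStep i a i = a i := if_pos rfl

theorem harmStep_comm (i j : Fin 3) (a : Fin 3 → ℝ) : harmStep i a j = harmStep j a i := by
  by_cases h : j = i
  · rw [h]
  · rw [harmStep, harmStep, if_neg h, if_neg (Ne.symm h), add_comm (a i)]

theorem abs_harmStep_sub_le {a : Fin 3 → ℝ} {c r : ℝ} (h : ∀ j, |a j - c| ≤ r) (i j : Fin 3) :
    |harmStep i a j - c| ≤ r := by
  have h0 := abs_le.1 (h 0)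
  have h1 := abs_le.1 (h 1)
  have h2 := abs_le.1 (h 2)
  rw [abs_le]
  fin_cases i <;> fin_cases j <;> simp [harmStep, Fin.sum_univ_three] <;>
    constructor <;> linarith

/-- Passing to a cell of level one contracts the oscillation by the factor `3/5`. -/
theorem abs_harmStep_sub_harmStep_le {a : Fin 3 → ℝ} {r : ℝ} (h : ∀ i j, |a i - a j| ≤ r)
    (k i j : Fin 3) : |harmStep k a i - harmStep k a j| ≤ 3 / 5 * r := by
  have h01 := abs_le.1 (h 0 1)
  have h12 := abs_le.1 (h 1 2)
  have h20 := abs_le.1 (h 2 0)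
  rw [abs_le]
  fin_cases k <;> fin_cases i <;> fin_cases j <;> simp [harmStep, Fin.sum_univ_three] <;>
    first | (constructor <;> linarith) | linarith

/-- Functions converging to the harmonic function with boundary values `a`: the affine function
with these values for `n = 0`, and for `n = m` the function that obeys the `1/5`-`2/5` rule down to
the cells of level `m` and is affine on each of them. -/
def approxHarm : ℕ → (Fin 3 → ℝ) → SG → ℝ
  | 0, a => fun x => ∑ i, a i * bary i x
  | n + 1, a => glue fun i => approxHarm n (harmStep i a)

theorem approxHarm_q (n : ℕ) (a : Fin 3 → ℝ) (j : Fin 3) : approxHarm n a (q j) = a j := by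
  induction n generalizing a j with
  | zero => simp [approxHarm, bary_q]
  | succ n ih =>
    rw [approxHarm, glue_q (fun i j => by rw [ih, ih, harmStep_comm]), ih, harmStep_self]

theorem approxHarm_succ_comp (n : ℕ) (a : Fin 3 → ℝ) (i : Fin 3) :
    approxHarm (n + 1) a ∘ Fmap i = approxHarm n (harmStep i a) :=
  glue_comp (g := fun i => approxHarm n (harmStep i a))
    (fun i j => by rw [approxHarm_q, approxHarm_q, harmStep_comm]) i

theorem continuous_approxHarm (n : ℕ) (a : Fin 3 → ℝ) : Continuous (approxHarm n a) := by
  induction n generalizing a with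
  | zero =>
    exact continuous_finsetSum _ fun i _ =>
      continuous_const.mul ((continuous_bary i).comp continuous_subtype_val)
  | succ n ih =>
    exact continuous_of_comp_Fmap fun i => by rw [approxHarm_succ_comp]; exact ih _

theorem abs_approxHarm_sub_le (n : ℕ) {a : Fin 3 → ℝ} {c r : ℝ} (h : ∀ j, |a j - c| ≤ r) (x : SG) :
    |approxHarm n a x - c| ≤ r := by
  induction n generalizing a x with
  | zero =>
    have h1 : approxHarm 0 a x - c = ∑ i, (a i - c) * bary i x := by
      simp only [sub_mul, Finset.sum_sub_distrib, ← Finset.mul_sum, sum_bary, approxHarm, mul_one]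
    rw [h1]
    calc |∑ i, (a i - c) * bary i x| ≤ ∑ i, |(a i - c) * bary i x| :=
          Finset.abs_sum_le_sum_abs _ _
      _ ≤ ∑ i, r * bary i x := by
          refine Finset.sum_le_sum fun i _ => ?_
          rw [abs_mul, abs_of_nonneg (bary_nonneg i x)]
          exact mul_le_mul_of_nonneg_right (h i) (bary_nonneg i x)
      _ = r := by rw [← Finset.mul_sum, sum_bary, mul_one]
  | succ n ih =>
    obtain ⟨i, y, rfl⟩ := exists_Fmap_eq x
    have h1 := congrFun (approxHarm_succ_comp n a i) y
    simp only [Function.comp] at h1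
    rw [h1]
    exact ih (fun j => abs_harmStep_sub_le h i j) y

theorem dist_approxHarm_succ_le (n : ℕ) {a : Fin 3 → ℝ} {r : ℝ} (h : ∀ i j, |a i - a j| ≤ r)
    (x : SG) : dist (approxHarm n a x) (approxHarm (n + 1) a x) ≤ 2 * r * (3 / 5) ^ n := by
  induction n generalizing a r x with
  | zero =>
    refine (dist_triangle_right _ _ (a 0)).trans ?_
    have h0 := abs_approxHarm_sub_le 0 (fun j => h j 0) x
    have h1 := abs_approxHarm_sub_le 1 (fun j => h j 0) x
    rw [Real.dist_eq, Real.dist_eq, pow_zero]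
    linarith
  | succ n ih =>
    obtain ⟨i, y, rfl⟩ := exists_Fmap_eq x
    have h1 := ih (abs_harmStep_sub_harmStep_le h i) y
    rw [← approxHarm_succ_comp, ← approxHarm_succ_comp] at h1
    refine h1.trans_eq ?_
    ring

/-- The harmonic function with boundary values `a`. -/
def harm (a : Fin 3 → ℝ) (x : SG) : ℝ := limUnder atTop fun n => approxHarm n a x

theorem abs_sub_le_of_fin_three (a : Fin 3 → ℝ) (i j : Fin 3) : |a i - a j| ≤ 2 * ∑ k, |a k| := by
  have hi := Finset.single_le_sum (f := fun k => |a k|) (fun k _ => abs_nonneg _)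
    (Finset.mem_univ i)
  have hj := Finset.single_le_sum (f := fun k => |a k|) (fun k _ => abs_nonneg _)
    (Finset.mem_univ j)
  have := abs_sub (a i) (a j)
  linarith

theorem tendsto_approxHarm (a : Fin 3 → ℝ) (x : SG) :
    Tendsto (fun n => approxHarm n a x) atTop (𝓝 (harm a x)) :=
  (cauchySeq_of_le_geometric (3 / 5) _ (by norm_num) fun n =>
    dist_approxHarm_succ_le n (abs_sub_le_of_fin_three a) x).tendsto_limUnder

theorem continuous_harm (a : Fin 3 → ℝ) : Continuous (harm a) := by
  have hu : TendstoUniformly (fun n => approxHarm n a) (harm a) atTop := by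
    rw [Metric.tendstoUniformly_iff]
    intro ε hε
    have h0 : Tendsto (fun n : ℕ => 2 * (2 * ∑ k, |a k|) * (3 / 5 : ℝ) ^ n / (1 - 3 / 5)) atTop
        (𝓝 0) := by
      simpa using ((tendsto_pow_atTop_nhds_zero_of_lt_one (r := (3 / 5 : ℝ)) (by norm_num)
        (by norm_num)).const_mul (2 * (2 * ∑ k, |a k|))).div_const (1 - 3 / 5)
    filter_upwards [h0.eventually_lt_const hε] with n hn x
    rw [dist_comm]
    exact (dist_le_of_le_geometric_of_tendsto (3 / 5) _ (by norm_num) (fun n =>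
      dist_approxHarm_succ_le n (abs_sub_le_of_fin_three a) x) (tendsto_approxHarm a x) n).trans_lt
      hn
  exact hu.continuous (Frequently.of_forall fun n => continuous_approxHarm n a)

theorem harm_q (a : Fin 3 → ℝ) (j : Fin 3) : harm a (q j) = a j :=
  tendsto_nhds_unique (tendsto_approxHarm a (q j)) (by simp only [approxHarm_q, tendsto_const_nhds])

theorem harm_comp_Fmap (a : Fin 3 → ℝ) (i : Fin 3) : harm a ∘ Fmap i = harm (harmStep i a) := by
  funext x
  have h : ∀ n, approxHarm (n + 1) a (Fmap i x) = approxHarm n (harmStep i a) x := fun n =>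
    congrFun (approxHarm_succ_comp n a i) x
  refine tendsto_nhds_unique ((tendsto_add_atTop_iff_nat 1).2 (tendsto_approxHarm a (Fmap i x))) ?_
  simpa only [h] using tendsto_approxHarm (harmStep i a) x

/-- The maximum principle. -/
theorem abs_harm_sub_le {a : Fin 3 → ℝ} {c r : ℝ} (h : ∀ j, |a j - c| ≤ r) (x : SG) :
    |harm a x - c| ≤ r :=
  le_of_tendsto ((tendsto_approxHarm a x).sub_const c).abs
    (Eventually.of_forall fun n => abs_approxHarm_sub_le n h x)

theorem harm_Fmap_q (a : Fin 3 → ℝ) (i j : Fin 3) : harm a (Fmap i (q j)) = harmStep i a j := by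
  have := congrFun (harm_comp_Fmap a i) (q j)
  rwa [harm_q] at this

theorem energyLevel_one_harm (a : Fin 3 → ℝ) (v : SG → ℝ) :
    energyLevel 1 (harm a) v = energyZero (harm a) v := by
  rw [energyLevel_succ]
  simp only [energyLevel_zero, energyZero_eq, Fin.sum_univ_three, Function.comp, Fmap_q_self,
    Fmap_q_comm 1 0, Fmap_q_comm 2 0, Fmap_q_comm 2 1, harm_Fmap_q, harm_q]
  simp [harmStep, Fin.sum_univ_three]
  ring

theorem energyLevel_harm (m : ℕ) (a : Fin 3 → ℝ) (v : SG → ℝ) :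
    energyLevel m (harm a) v = energyZero (harm a) v := by
  induction m generalizing a v with
  | zero => exact energyLevel_zero _ _
  | succ m ih =>
    rw [energyLevel_succ, ← energyLevel_one_harm, energyLevel_succ]
    simp only [harm_comp_Fmap, ih, energyLevel_zero]

/-- The continuous function with the values of `φ` on `V_m` that is harmonic on each cell of level
`m`. -/
def piecewiseHarm : ℕ → (SG → ℝ) → SG → ℝ
  | 0, φ => harm fun i => φ (q i)
  | m + 1, φ => glue fun i => piecewiseHarm m (φ ∘ Fmap i)

theorem piecewiseHarm_q (m : ℕ) (φ : SG → ℝ) (i : Fin 3) : piecewiseHarm m φ (q i) = φ (q i) := by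
  induction m generalizing φ i with
  | zero => exact harm_q _ i
  | succ m ih =>
    rw [piecewiseHarm, glue_q fun i j => by rw [ih, ih, Function.comp, Function.comp, Fmap_q_comm],
      ih, Function.comp, Fmap_q_self]

theorem piecewiseHarm_succ_comp (m : ℕ) (φ : SG → ℝ) (i : Fin 3) :
    piecewiseHarm (m + 1) φ ∘ Fmap i = piecewiseHarm m (φ ∘ Fmap i) :=
  glue_comp (g := fun i => piecewiseHarm m (φ ∘ Fmap i)) (fun i j => by
    rw [piecewiseHarm_q, piecewiseHarm_q, Function.comp, Function.comp, Fmap_q_comm]) i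

theorem continuous_piecewiseHarm (m : ℕ) (φ : SG → ℝ) : Continuous (piecewiseHarm m φ) := by
  induction m generalizing φ with
  | zero => exact continuous_harm _
  | succ m ih =>
    exact continuous_of_comp_Fmap fun i => by rw [piecewiseHarm_succ_comp]; exact ih _

theorem piecewiseHarm_comp_Fword (φ : SG → ℝ) (w : List (Fin 3)) :
    piecewiseHarm w.length φ ∘ Fword w = harm fun i => φ (Fword w (q i)) := by
  induction w generalizing φ with
  | nil => rfl
  | cons i w ih =>
    rw [List.length_cons, Fword, ← Function.comp_assoc, piecewiseHarm_succ_comp, ih]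
    rfl

theorem piecewiseHarm_Fword_q (φ : SG → ℝ) (w : List (Fin 3)) (i : Fin 3) :
    piecewiseHarm w.length φ (Fword w (q i)) = φ (Fword w (q i)) := by
  have := congrFun (piecewiseHarm_comp_Fword φ w) (q i)
  rwa [harm_q] at this

theorem abs_piecewiseHarm_sub_le {φ : SG → ℝ} {c r : ℝ} (w : List (Fin 3))
    (h : ∀ i, |φ (Fword w (q i)) - c| ≤ r) (x : SG) :
    |piecewiseHarm w.length φ (Fword w x) - c| ≤ r := by
  have := congrFun (piecewiseHarm_comp_Fword φ w) x
  simp only [Function.comp] at this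
  rw [this]
  exact abs_harm_sub_le h x

theorem energyLevel_add_piecewiseHarm (m k : ℕ) (φ v : SG → ℝ) :
    energyLevel (m + k) (piecewiseHarm m φ) v = energyLevel m φ v := by
  induction m generalizing φ v with
  | zero =>
    rw [Nat.zero_add, piecewiseHarm, energyLevel_harm, energyLevel_zero]
    simp only [energyZero_eq, harm_q]
  | succ m ih =>
    rw [Nat.add_right_comm, energyLevel_succ, energyLevel_succ]
    simp only [piecewiseHarm_succ_comp, ih]

theorem piecewiseHarm_mem_domE (m : ℕ) (φ : SG → ℝ) : piecewiseHarm m φ ∈ domE := by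
  refine mem_domE_of_le (continuous_piecewiseHarm m φ)
    (C := energyLevel m φ (piecewiseHarm m φ)) fun k => ?_
  rw [← energyLevel_add_piecewiseHarm m k φ]
  exact monotone_energyLevel _ (Nat.le_add_left k m)

theorem piecewiseHarm_mem_domE0 (m : ℕ) {φ : SG → ℝ} (hφ : ∀ i, φ (q i) = 0) :
    piecewiseHarm m φ ∈ domE0 :=
  ⟨piecewiseHarm_mem_domE m φ, fun i => by rw [piecewiseHarm_q, hφ]⟩

theorem harm_mem_domE (a : Fin 3 → ℝ) : harm a ∈ domE := by
  have := piecewiseHarm_mem_domE 0 (harm a)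
  simpa only [piecewiseHarm, harm_q] using this

theorem energy_piecewiseHarm (m : ℕ) (φ : SG → ℝ) {v : SG → ℝ} (hv : v ∈ domE) :
    energy (piecewiseHarm m φ) v = energyLevel m φ v := by
  refine tendsto_nhds_unique ((tendsto_add_atTop_iff_nat m).2
    (tendsto_energyLevel (piecewiseHarm_mem_domE m φ) hv)) ?_
  simp only [add_comm _ m, energyLevel_add_piecewiseHarm, tendsto_const_nhds]

theorem energy_harm (a : Fin 3 → ℝ) {v : SG → ℝ} (hv : v ∈ domE) :
    energy (harm a) v = energyZero (harm a) v :=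
  tendsto_nhds_unique (tendsto_energyLevel (harm_mem_domE a) hv)
    (by simp only [energyLevel_harm, tendsto_const_nhds])

theorem energy_harm_of_mem_domE0 (a : Fin 3 → ℝ) {v : SG → ℝ} (hv : v ∈ domE0) :
    energy (harm a) v = 0 := by
  rw [energy_harm a hv.1, energyZero_eq, hv.2, hv.2, hv.2]
  ring

theorem sub_harm_mem_domE0 {u : SG → ℝ} (hu : u ∈ domE) : u - harm (fun i => u (q i)) ∈ domE0 :=
  ⟨sub_mem_domE hu (harm_mem_domE _), fun i => by rw [Pi.sub_apply, harm_q, sub_self]⟩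

/-- A function orthogonal to `domE0` is determined by its boundary values. -/
theorem eq_harm_of_energy_eq_zero {u : SG → ℝ} (hu : u ∈ domE) (h : ∀ v ∈ domE0, energy u v = 0) :
    u = harm fun i => u (q i) := by
  have h0 := sub_harm_mem_domE0 hu
  refine sub_eq_zero.1 (eq_zero_of_energy_eq_zero h0 ?_)
  rw [energy_sub_left hu (harm_mem_domE _) h0.1, h _ h0, energy_harm_of_mem_domE0 _ h0, sub_zero]

theorem harm_add (a b : Fin 3 → ℝ) : harm (a + b) = harm a + harm b := by
  rw [eq_harm_of_energy_eq_zero (add_mem_domE (harm_mem_domE a) (harm_mem_domE b)) fun v hv => by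
    rw [energy_add_left (harm_mem_domE a) (harm_mem_domE b) hv.1, energy_harm_of_mem_domE0 a hv,
      energy_harm_of_mem_domE0 b hv, add_zero]]
  simp only [Pi.add_apply, harm_q]
  rfl

theorem harm_smul (c : ℝ) (a : Fin 3 → ℝ) : harm (c • a) = c • harm a := by
  rw [eq_harm_of_energy_eq_zero (smul_mem_domE c (harm_mem_domE a)) fun v hv => by
    rw [energy_smul_left c (harm_mem_domE a) hv.1, energy_harm_of_mem_domE0 a hv, mul_zero]]
  simp only [Pi.smul_apply, harm_q]
  rfl

/-- The harmonic functions `h_0, h_1, h_2` with `h_j (q_i) = δ_{ij}`. -/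
def harmBasis (j : Fin 3) : SG → ℝ := harm fun i => if i = j then 1 else 0

theorem harm_apply_eq_sum (a : Fin 3 → ℝ) (x : SG) : harm a x = ∑ j, a j * harmBasis j x := by
  let L : (Fin 3 → ℝ) →ₗ[ℝ] SG → ℝ :=
    { toFun := harm, map_add' := harm_add, map_smul' := harm_smul }
  have h := congrFun (LinearMap.pi_apply_eq_sum_univ L a) x
  simp only [L, LinearMap.coe_mk, AddHom.coe_mk, Finset.sum_apply, Pi.smul_apply, smul_eq_mul] at h
  rw [h]
  refine Finset.sum_congr rfl fun j _ => ?_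
  simp only [harmBasis, eq_comm]

theorem abs_harmBasis_le (j : Fin 3) (x : SG) : |harmBasis j x| ≤ 1 := by
  have := abs_harm_sub_le (a := fun i => if i = j then 1 else 0) (c := 0) (r := 1)
    (fun i => by by_cases h : i = j <;> simp [h]) x
  rwa [sub_zero] at this

/-- A harmonic function is determined by its values at the three midpoints, since the matrix of the
`1/5`-`2/5` rule is invertible. -/
theorem eq_zero_of_harm_eq_zero {a : Fin 3 → ℝ} (h : ∀ x ∉ V 0, harm a x = 0) : a = 0 := by
  have hm : ∀ i j : Fin 3, i ≠ j → harmStep i a j = 0 := by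
    intro i j hij
    rw [← harm_Fmap_q]
    refine h _ fun hV => ?_
    obtain ⟨k, hk⟩ := mem_V_zero.1 hV
    obtain ⟨rfl, hjk⟩ := eq_q_of_Fmap_eq_q hk
    exact hij (q_injective hjk).symm
  have h01 := hm 0 1 (by decide)
  have h02 := hm 0 2 (by decide)
  have h12 := hm 1 2 (by decide)
  simp [harmStep, Fin.sum_univ_three] at h01 h02 h12
  funext i
  fin_cases i <;> simp <;> linarith

/-- Minimality gives `ℰ(h - H) ≤ 0` for the difference of `h` and the function `H` of the
construction above with the same boundary values, as the mixed term `ℰ(H, h - H)` vanishes. -/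
theorem IsHarmonic.eq_harm {h : SG → ℝ} (hh : IsHarmonic h) : h = harm fun i => h (q i) := by
  set H := harm fun i => h (q i) with hH
  have h0 : h - H ∈ domE0 := sub_harm_mem_domE0 hh.1
  have hHE : H ∈ domE := harm_mem_domE _
  have h1 : energy h h ≤ energy H H := hh.2 H hHE fun i => harm_q _ i
  have h2 : energy H (h - H) = 0 := energy_harm_of_mem_domE0 _ h0
  have h3 : energy (h - H) (h - H) = energy h h - energy H H - 2 * energy H (h - H) := by
    rw [energy_sub_left hh.1 hHE h0.1, energy_sub_right hh.1 hh.1 hHE,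
      energy_sub_right hHE hh.1 hHE, energy_comm h H]
    ring
  exact sub_eq_zero.1 (eq_zero_of_energy_eq_zero h0
    (le_antisymm (by linarith) (energy_self_nonneg h0.1)))

/-! ### The Hilbert space of functions of finite energy vanishing on the boundary -/

theorem zero_mem_domE : (0 : SG → ℝ) ∈ domE := by
  have := smul_mem_domE 0 (harm_mem_domE 0)
  rwa [zero_smul] at this

/-- `domE0` as a linear subspace. -/
def domE0Submodule : Submodule ℝ (SG → ℝ) where
  carrier := domE0
  zero_mem' := ⟨zero_mem_domE, fun _ => rfl⟩
  add_mem' hu hv := ⟨add_mem_domE hu.1 hv.1, fun i => by simp [hu.2 i, hv.2 i]⟩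
  smul_mem' c u hu := ⟨smul_mem_domE c hu.1, fun i => by simp [hu.2 i]⟩

/-- `domE0` with the energy as inner product. A type synonym of the subspace, which would otherwise
carry the topology of pointwise convergence. -/
def EnergySpace : Type := domE0Submodule

instance : AddCommGroup EnergySpace := inferInstanceAs (AddCommGroup domE0Submodule)

instance : Module ℝ EnergySpace := inferInstanceAs (Module ℝ domE0Submodule)

/-- The function underlying an element of the energy space. -/
def EnergySpace.toFun (u : EnergySpace) : SG → ℝ := Subtype.val (p := (· ∈ domE0Submodule)) u

theorem EnergySpace.mem (u : EnergySpace) : u.toFun ∈ domE0 :=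
  Subtype.property (p := (· ∈ domE0Submodule)) u

theorem EnergySpace.ext {u v : EnergySpace} (h : u.toFun = v.toFun) : u = v := Subtype.ext h

theorem EnergySpace.toFun_sub (u v : EnergySpace) : (u - v).toFun = u.toFun - v.toFun := rfl

/-- The element of the energy space given by a function in `domE0`. -/
def EnergySpace.mk (u : SG → ℝ) (hu : u ∈ domE0) : EnergySpace :=
  Subtype.mk (p := (· ∈ domE0Submodule)) u hu

/-- The energy is an inner product on `domE0`. -/
@[reducible] def energyCore : InnerProductSpace.Core ℝ EnergySpace where
  inner u v := energy u.toFun v.toFun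
  conj_inner_symm _ _ := energy_comm _ _
  re_inner_nonneg u := energy_self_nonneg u.mem.1
  add_left u v w := energy_add_left u.mem.1 v.mem.1 w.mem.1
  smul_left u v c := energy_smul_left c u.mem.1 v.mem.1
  definite u h := EnergySpace.ext (eq_zero_of_energy_eq_zero u.mem h)

instance : NormedAddCommGroup EnergySpace := energyCore.toNormedAddCommGroup

instance : InnerProductSpace ℝ EnergySpace := InnerProductSpace.ofCore energyCore.toCore

theorem EnergySpace.inner_eq (u v : EnergySpace) : inner ℝ u v = energy u.toFun v.toFun := rfl

theorem EnergySpace.norm_eq (u : EnergySpace) : ‖u‖ = Real.sqrt (energy u.toFun u.toFun) := by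
  rw [← EnergySpace.inner_eq, real_inner_self_eq_norm_sq, Real.sqrt_sq (norm_nonneg _)]

theorem EnergySpace.abs_apply_le (u : EnergySpace) (x : SG) : |u.toFun x| ≤ 5 * ‖u‖ := by
  have := abs_sub_le_energy u.mem.1 x
  rwa [u.mem.2 0, sub_zero, ← u.norm_eq] at this

/-- The energy norm dominates the supremum norm. -/
def EnergySpace.toContinuousMap : EnergySpace →L[ℝ] C(SG, ℝ) :=
  LinearMap.mkContinuous
    { toFun := fun u => ⟨u.toFun, u.mem.1.1⟩
      map_add' := fun _ _ => rfl
      map_smul' := fun _ _ => rfl } 5 fun u =>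
    (ContinuousMap.norm_le _ (by positivity)).2 u.abs_apply_le

theorem tendsto_energyLevel_of_pointwise {u : ℕ → SG → ℝ} {g : SG → ℝ}
    (h : ∀ x, Tendsto (fun n => u n x) atTop (𝓝 (g x))) (m : ℕ) :
    Tendsto (fun n => energyLevel m (u n) (u n)) atTop (𝓝 (energyLevel m g g)) := by
  unfold energyLevel energyZero
  refine Tendsto.const_mul _ (tendsto_finsetSum _ fun w _ => tendsto_finsetSum _ fun i _ => ?_)
  exact ((h _).sub (h _)).mul ((h _).sub (h _))

/-- A Cauchy sequence converges uniformly; its limit has finite energy, and is the limit in energy,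
because the graph energies are continuous under pointwise convergence. -/
instance : CompleteSpace EnergySpace := by
  refine Metric.complete_of_cauchySeq_tendsto fun u hu => ?_
  obtain ⟨g, hg⟩ := cauchySeq_tendsto_of_complete
    (EnergySpace.toContinuousMap.uniformContinuous.comp_cauchySeq hu)
  have hpt : ∀ x, Tendsto (fun n => (u n).toFun x) atTop (𝓝 (g x)) := fun x =>
    ((continuous_eval_const x).tendsto g).comp hg
  have key : ∀ ε > 0, ∃ N, ∀ n ≥ N, ∀ m,
      energyLevel m (g - (u n).toFun) (g - (u n).toFun) ≤ ε ^ 2 := by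
    intro ε hε
    obtain ⟨N, hN⟩ := Metric.cauchySeq_iff.1 hu ε hε
    refine ⟨N, fun n hn m => ?_⟩
    refine le_of_tendsto (tendsto_energyLevel_of_pointwise
      (u := fun k => (u k).toFun - (u n).toFun) (fun x => (hpt x).sub_const _) m) ?_
    filter_upwards [eventually_ge_atTop N] with k hk
    have h1 := hN k hk n hn
    rw [dist_eq_norm] at h1
    rw [← EnergySpace.toFun_sub]
    refine (energyLevel_le_energy (u k - u n).mem.1 m).trans ?_
    rw [← EnergySpace.inner_eq, real_inner_self_eq_norm_sq]
    gcongr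
  have hgE : (g : SG → ℝ) ∈ domE0 := by
    refine ⟨?_, fun i => ?_⟩
    · obtain ⟨N, hN⟩ := key 1 one_pos
      have := add_mem_domE (mem_domE_of_le (g.continuous.sub (u N).mem.1.1) (hN N le_rfl))
        (u N).mem.1
      rwa [sub_add_cancel] at this
    · exact tendsto_nhds_unique (hpt (q i)) (by simp only [(u _).mem.2, tendsto_const_nhds])
  refine ⟨EnergySpace.mk g hgE, Metric.tendsto_atTop'.2 fun ε hε => ?_⟩
  obtain ⟨N, hN⟩ := key (ε / 2) (half_pos hε)
  refine ⟨N, fun n hn => ?_⟩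
  have h1 : energy (EnergySpace.mk g hgE - u n).toFun (EnergySpace.mk g hgE - u n).toFun ≤
      (ε / 2) ^ 2 :=
    le_of_tendsto' (tendsto_energyLevel_self (EnergySpace.mem _).1) (hN n hn.le)
  rw [dist_comm, dist_eq_norm, EnergySpace.norm_eq]
  calc Real.sqrt _ ≤ Real.sqrt ((ε / 2) ^ 2) := Real.sqrt_le_sqrt h1
    _ = ε / 2 := Real.sqrt_sq (half_pos hε).le
    _ < ε := half_lt_self hε

/-! ### The Laplacian -/

variable {ζ : Measure SG}

theorem integrable_Lp_mul [IsFiniteMeasure ζ] (f : Lp ℝ 2 ζ) {v : SG → ℝ} (hv : Measurable v)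
    {C : ℝ} (hC : ∀ x, |v x| ≤ C) : Integrable (fun x => f x * v x) ζ :=
  ((Lp.memLp f).integrable one_le_two).mul_bdd hv.aestronglyMeasurable
    (Eventually.of_forall hC)

theorem memLp_of_abs_le [IsFiniteMeasure ζ] {v : SG → ℝ} (hv : Measurable v) {C : ℝ}
    (hC : ∀ x, |v x| ≤ C) : MemLp v 2 ζ :=
  MemLp.of_bound hv.aestronglyMeasurable C (Eventually.of_forall hC)

theorem inner_toLp (f : Lp ℝ 2 ζ) {v : SG → ℝ} (hv : MemLp v 2 ζ) :
    inner ℝ f hv.toLp = ∫ x, f x * v x ∂ζ := by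
  rw [L2.inner_def]
  refine integral_congr_ae ?_
  filter_upwards [hv.coeFn_toLp] with x hx
  rw [hx, real_inner_eq_re_inner]
  simp [mul_comm]

theorem exists_abs_le {v : SG → ℝ} (hv : Continuous v) : ∃ C, ∀ x, |v x| ≤ C := by
  obtain ⟨C, hC⟩ := isCompact_univ.exists_bound_of_continuousOn hv.continuousOn
  exact ⟨C, fun x => hC x (Set.mem_univ x)⟩

theorem memLp_of_continuous [IsFiniteMeasure ζ] {v : SG → ℝ} (hv : Continuous v) : MemLp v 2 ζ := by
  obtain ⟨C, hC⟩ := exists_abs_le hv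
  exact memLp_of_abs_le hv.measurable hC

theorem inner_toLp_continuousMap [IsFiniteMeasure ζ] (f : Lp ℝ 2 ζ) (v : C(SG, ℝ)) :
    inner ℝ f (ContinuousMap.toLp 2 ζ ℝ v) = ∫ x, f x * v x ∂ζ := by
  rw [← inner_toLp f (memLp_of_continuous v.continuous)]
  refine congrArg _ (Lp.ext ?_)
  exact (ContinuousMap.coeFn_toLp (𝕜 := ℝ) ζ v).trans (MemLp.coeFn_toLp _).symm

variable (ζ) in
/-- The Green operator: `-greenOperator f` represents the functional `v ↦ ∫ f v dζ` on the energy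
space, so that `greenOperator f` solves the Dirichlet problem for `Δ_ζ u = f`. -/
def greenOperator [IsFiniteMeasure ζ] : Lp ℝ 2 ζ →L[ℝ] EnergySpace :=
  -ContinuousLinearMap.adjoint
    ((ContinuousMap.toLp 2 ζ ℝ : C(SG, ℝ) →L[ℝ] Lp ℝ 2 ζ) ∘L EnergySpace.toContinuousMap)

theorem energy_greenOperator [IsFiniteMeasure ζ] (f : Lp ℝ 2 ζ) {v : SG → ℝ} (hv : v ∈ domE0) :
    energy (greenOperator ζ f).toFun v = -∫ x, f x * v x ∂ζ := by
  have h : energy (greenOperator ζ f).toFun v =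
      inner ℝ (greenOperator ζ f) (EnergySpace.mk v hv) := rfl
  rw [h, greenOperator, neg_apply, inner_neg_left,
    ContinuousLinearMap.adjoint_inner_left, ContinuousLinearMap.comp_apply,
    inner_toLp_continuousMap]
  rfl

theorem continuous_greenOperator_apply [IsFiniteMeasure ζ] (x : SG) :
    Continuous fun f : Lp ℝ 2 ζ => (greenOperator ζ f).toFun x :=
  (continuous_eval_const x).comp
    (EnergySpace.toContinuousMap.continuous.comp (greenOperator ζ).continuous)

theorem hasLaplacian_harm_add_green [IsFiniteMeasure ζ] (a : Fin 3 → ℝ) (f : Lp ℝ 2 ζ) :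
    HasLaplacian ζ (harm a + (greenOperator ζ f).toFun) f := by
  refine ⟨add_mem_domE (harm_mem_domE a) (greenOperator ζ f).mem.1, fun v hv => ?_⟩
  rw [energy_add_left (harm_mem_domE a) (greenOperator ζ f).mem.1 hv.1,
    energy_harm_of_mem_domE0 a hv, energy_greenOperator f hv, zero_add]

theorem integral_add_Lp_mul [IsFiniteMeasure ζ] (f g : Lp ℝ 2 ζ) {v : SG → ℝ} (hv : Continuous v) :
    ∫ x, (f + g : Lp ℝ 2 ζ) x * v x ∂ζ = ∫ x, f x * v x ∂ζ + ∫ x, g x * v x ∂ζ := by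
  simp only [← inner_toLp _ (memLp_of_continuous hv), inner_add_left]

theorem integral_smul_Lp_mul [IsFiniteMeasure ζ] (c : ℝ) (f : Lp ℝ 2 ζ) {v : SG → ℝ}
    (hv : Continuous v) :
    ∫ x, (c • f : Lp ℝ 2 ζ) x * v x ∂ζ = c * ∫ x, f x * v x ∂ζ := by
  simp only [← inner_toLp _ (memLp_of_continuous hv), real_inner_smul_left]

theorem HasLaplacian.add [IsFiniteMeasure ζ] {u v : SG → ℝ} {f g : Lp ℝ 2 ζ}
    (hu : HasLaplacian ζ u f) (hv : HasLaplacian ζ v g) : HasLaplacian ζ (u + v) (f + g) := by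
  refine ⟨add_mem_domE hu.1 hv.1, fun φ hφ => ?_⟩
  rw [energy_add_left hu.1 hv.1 hφ.1, hu.2 φ hφ, hv.2 φ hφ, integral_add_Lp_mul f g hφ.1.1]
  ring

theorem HasLaplacian.smul [IsFiniteMeasure ζ] (c : ℝ) {u : SG → ℝ} {f : Lp ℝ 2 ζ}
    (hu : HasLaplacian ζ u f) :
    HasLaplacian ζ (c • u) (c • f) := by
  refine ⟨smul_mem_domE c hu.1, fun φ hφ => ?_⟩
  rw [energy_smul_left c hu.1 hφ.1, hu.2 φ hφ, integral_smul_Lp_mul c f hφ.1.1]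
  ring

/-- Functions with the same Laplacian differ by a harmonic function. -/
theorem HasLaplacian.sub_eq_harm {u v : SG → ℝ} {f : Lp ℝ 2 ζ} (hu : HasLaplacian ζ u f)
    (hv : HasLaplacian ζ v f) : u - v = harm fun i => (u - v) (q i) :=
  eq_harm_of_energy_eq_zero (sub_mem_domE hu.1 hv.1) fun φ hφ => by
    rw [energy_sub_left hu.1 hv.1 hφ.1, hu.2 φ hφ, hv.2 φ hφ, sub_self]

theorem tendsto_piecewiseHarm {φ : SG → ℝ} {x : SG} (h : ContinuousAt φ x) :
    Tendsto (fun n => piecewiseHarm n φ x) atTop (𝓝 (φ x)) := by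
  rw [Metric.tendsto_nhds]
  intro ε hε
  obtain ⟨δ, hδ, hφ⟩ := Metric.continuousAt_iff.1 h (ε / 2) (half_pos hε)
  filter_upwards [eventually_dist_Fword_lt hδ] with n hn
  obtain ⟨w, y, rfl, rfl⟩ := exists_Fword_eq n x
  refine lt_of_le_of_lt (abs_piecewiseHarm_sub_le (r := ε / 2) w (fun i => ?_) y)
    (half_lt_self hε)
  rw [← Real.dist_eq]
  exact (hφ (hn w _ _ rfl)).le

theorem abs_piecewiseHarm_le {φ : SG → ℝ} {C : ℝ} (h : ∀ x, |φ x| ≤ C) (n : ℕ) (x : SG) :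
    |piecewiseHarm n φ x| ≤ C := by
  obtain ⟨w, y, rfl, rfl⟩ := exists_Fword_eq n x
  have := abs_piecewiseHarm_sub_le (φ := φ) (c := 0) (r := C) w (fun i => by simpa using h _) y
  rwa [sub_zero] at this

theorem measure_V [NullSingletonClass ζ] (m : ℕ) : ζ (V m) = 0 :=
  (finite_V m).measure_zero ζ

/-- `domE0` is dense in `L²(ζ)`: the piecewise harmonic interpolations of a continuous function,
with the boundary values replaced by `0`, converge to it boundedly and off the null set `V_0`. -/
theorem eq_zero_of_integral_mul_domE0_eq_zero [IsFiniteMeasure ζ] [NullSingletonClass ζ]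
    {g : Lp ℝ 2 ζ} (h : ∀ v ∈ domE0, ∫ x, g x * v x ∂ζ = 0) : g = 0 := by
  have hC : ∀ φ : C(SG, ℝ), ∫ x, g x * φ x ∂ζ = 0 := by
    intro φ
    set ψ : SG → ℝ := (V 0)ᶜ.indicator φ with hψ
    have hψC : ∀ x, |ψ x| ≤ ‖φ‖ := by
      intro x
      by_cases hx : x ∈ (V 0)ᶜ
      · rw [hψ, Set.indicator_of_mem hx]
        exact φ.norm_coe_le_norm x
      · rw [hψ, Set.indicator_of_notMem hx, abs_zero]
        exact norm_nonneg φ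
    have hlim : Tendsto (fun n => ∫ x, g x * piecewiseHarm n ψ x ∂ζ) atTop
        (𝓝 (∫ x, g x * φ x ∂ζ)) := by
      refine tendsto_integral_of_dominated_convergence (fun x => ‖g x‖ * ‖φ‖) (fun n => ?_) ?_
        (fun n => ?_) ?_
      · exact (integrable_Lp_mul g (continuous_piecewiseHarm n ψ).measurable
          (abs_piecewiseHarm_le hψC n)).aestronglyMeasurable
      · exact ((Lp.memLp g).integrable one_le_two).norm.mul_const _
      · refine Eventually.of_forall fun x => ?_
        rw [norm_mul]
        exact mul_le_mul_of_nonneg_left (abs_piecewiseHarm_le hψC n x) (norm_nonneg _)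
      · filter_upwards [measure_eq_zero_iff_ae_notMem.1 (measure_V (ζ := ζ) 0)] with x hx
        have hx' : ψ x = φ x := Set.indicator_of_mem hx _
        have hnear : ψ =ᶠ[𝓝 x] φ := by
          filter_upwards [(finite_V 0).isClosed.isOpen_compl.mem_nhds hx] with y hy
          exact Set.indicator_of_mem hy _
        rw [← hx']
        exact (tendsto_piecewiseHarm (φ.continuous.continuousAt.congr hnear.symm)).const_mul _
    have hzero : ∀ n, ∫ x, g x * piecewiseHarm n ψ x ∂ζ = 0 := fun n =>
      h _ (piecewiseHarm_mem_domE0 n fun i =>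
        Set.indicator_of_notMem (Set.notMem_compl_iff.2 (q_mem_V 0 i)) _)
    simp only [hzero] at hlim
    exact tendsto_nhds_unique hlim tendsto_const_nhds
  have hd : DenseRange (ContinuousMap.toLp 2 ζ ℝ : C(SG, ℝ) →L[ℝ] Lp ℝ 2 ζ) :=
    ContinuousMap.toLp_denseRange ℝ ζ ℝ (by norm_num)
  exact hd.eq_zero_of_inner_left ℝ fun φ => by rw [inner_toLp_continuousMap, hC]

/-- The Laplacian is unique. -/
theorem HasLaplacian.unique [IsFiniteMeasure ζ] [NullSingletonClass ζ] {u : SG → ℝ} {f g : Lp ℝ 2 ζ}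
    (hf : HasLaplacian ζ u f) (hg : HasLaplacian ζ u g) : f = g := by
  refine sub_eq_zero.1 (eq_zero_of_integral_mul_domE0_eq_zero (ζ := ζ) fun v hv => ?_)
  have h := hf.2 v hv
  rw [hg.2 v hv] at h
  rw [← inner_toLp _ (memLp_of_continuous hv.1.1), inner_sub_left, inner_toLp, inner_toLp]
  linarith

theorem T_eq_norm_sq [IsFiniteMeasure ζ] [NullSingletonClass ζ] {u : SG → ℝ} {f : Lp ℝ 2 ζ}
    (hf : HasLaplacian ζ u f) : T ζ u = ‖f‖ ^ 2 := by
  have hu : ∃ f : Lp ℝ 2 ζ, HasLaplacian ζ u f := ⟨f, hf⟩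
  have h : laplacian ζ u = f := by
    rw [laplacian, dif_pos hu]
    exact hu.choose_spec.unique hf
  rw [T, h, ← real_inner_self_eq_norm_sq, L2.inner_def]
  refine integral_congr_ae (Eventually.of_forall fun x => ?_)
  simp [sq]

/-! ### Normal derivatives -/

/-- The function `v` transplanted to the cell `F_w SG` and extended by zero. -/
def cellExtend (w : List (Fin 3)) (v : SG → ℝ) : SG → ℝ := Function.extend (Fword w) v fun _ => 0

theorem cellExtend_apply (w : List (Fin 3)) (v : SG → ℝ) (x : SG) :
    cellExtend w v (Fword w x) = v x :=
  (Fword_injective w).extend_apply v _ x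

theorem cellExtend_of_notMem (w : List (Fin 3)) (v : SG → ℝ) {x : SG}
    (hx : x ∉ Set.range (Fword w)) : cellExtend w v x = 0 :=
  Function.extend_apply' v _ x hx

theorem measurable_cellExtend (w : List (Fin 3)) {v : SG → ℝ} (hv : Measurable v) :
    Measurable (cellExtend w v) :=
  (isClosedEmbedding_Fword w).measurableEmbedding.measurable_extend hv measurable_const

theorem abs_cellExtend_le (w : List (Fin 3)) {v : SG → ℝ} {C : ℝ} (hC : ∀ x, |v x| ≤ C) (x : SG) :
    |cellExtend w v x| ≤ C := by
  by_cases hx : x ∈ Set.range (Fword w)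
  · obtain ⟨y, rfl⟩ := hx
    rw [cellExtend_apply]
    exact hC y
  · rw [cellExtend_of_notMem w v hx, abs_zero]
    exact (abs_nonneg _).trans (hC x)

theorem cellExtend_cons_comp_self (i : Fin 3) (w : List (Fin 3)) (v : SG → ℝ) :
    cellExtend (i :: w) v ∘ Fmap i = cellExtend w v := by
  funext x
  by_cases hx : x ∈ Set.range (Fword w)
  · obtain ⟨y, rfl⟩ := hx
    exact (cellExtend_apply (i :: w) v y).trans (cellExtend_apply w v y).symm
  · rw [cellExtend_of_notMem w v hx, Function.comp, cellExtend_of_notMem]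
    rintro ⟨y, hy⟩
    exact hx ⟨y, Fmap_injective i hy⟩

theorem cellExtend_cons_comp_of_ne {i j : Fin 3} (hij : i ≠ j) (w : List (Fin 3)) {v : SG → ℝ}
    (hv : ∀ i, v (q i) = 0) : cellExtend (i :: w) v ∘ Fmap j = 0 := by
  funext x
  by_cases hx : Fmap j x ∈ Set.range (Fword (i :: w))
  · obtain ⟨y, hy⟩ := hx
    have hyq : y = q j := Fword_eq_q (eq_q_of_Fmap_eq hij hy).1
    rw [Function.comp, ← hy, cellExtend_apply, hyq, hv, Pi.zero_apply]
  · exact cellExtend_of_notMem _ v hx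

theorem cellExtend_mem_domE0 (w : List (Fin 3)) {v : SG → ℝ} (hv : v ∈ domE0) :
    cellExtend w v ∈ domE0 := by
  constructor
  · induction w with
    | nil =>
      have : cellExtend [] v = v := funext fun x => cellExtend_apply [] v x
      rw [this]
      exact hv.1
    | cons i w ih =>
      refine mem_domE_of_comp_Fmap fun j => ?_
      by_cases hij : i = j
      · subst hij
        rwa [cellExtend_cons_comp_self]
      · rw [cellExtend_cons_comp_of_ne hij w hv.2]
        exact zero_mem_domE
  · intro i
    by_cases hx : q i ∈ Set.range (Fword w)
    · obtain ⟨y, hy⟩ := hx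
      rw [← hy, cellExtend_apply, Fword_eq_q hy, hv.2]
    · exact cellExtend_of_notMem w v hx

theorem energy_zero_right {u : SG → ℝ} (hu : u ∈ domE) : energy u 0 = 0 := by
  have := energy_sub_right hu hu hu
  rwa [sub_self, sub_self] at this

theorem energy_cellExtend (w : List (Fin 3)) {u v : SG → ℝ} (hu : u ∈ domE) (hv : v ∈ domE0) :
    energy u (cellExtend w v) = (5 / 3) ^ w.length * energy (u ∘ Fword w) v := by
  induction w generalizing u with
  | nil =>
    have : cellExtend [] v = v := funext fun x => cellExtend_apply [] v x
    rw [this]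
    simp [Fword]
  | cons i w ih =>
    rw [energy_eq_sum hu (cellExtend_mem_domE0 _ hv).1, Finset.sum_eq_single i,
      cellExtend_cons_comp_self, ih (comp_Fmap_mem_domE hu i), List.length_cons, pow_succ', Fword,
      Function.comp_assoc, mul_assoc]
    · intro j _ hj
      rw [cellExtend_cons_comp_of_ne hj.symm w hv.2, energy_zero_right (comp_Fmap_mem_domE hu j)]
    · simp

open Classical in
/-- The indicator function of the boundary point `q_i`. -/
def cornerIndicator (i : Fin 3) (x : SG) : ℝ := if x = q i then 1 else 0

theorem cornerIndicator_q (i j : Fin 3) : cornerIndicator i (q j) = if j = i then 1 else 0 := by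
  simp only [cornerIndicator, q_injective.eq_iff]

theorem cornerIndicator_comp_self (i : Fin 3) : cornerIndicator i ∘ Fmap i = cornerIndicator i := by
  funext x
  have h : Fmap i x = q i ↔ x = q i :=
    ⟨fun h => (eq_q_of_Fmap_eq_q h).2, fun h => by rw [h, Fmap_q_self]⟩
  simp only [cornerIndicator, Function.comp, h]

theorem cornerIndicator_comp_of_ne {i j : Fin 3} (hij : j ≠ i) :
    cornerIndicator i ∘ Fmap j = 0 := by
  funext x
  exact if_neg fun h => hij (eq_q_of_Fmap_eq_q h).1

theorem abs_cornerIndicator_le (i : Fin 3) (x : SG) : |cornerIndicator i x| ≤ 1 := by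
  unfold cornerIndicator
  split_ifs <;> simp

theorem piecewiseHarm_zero_cornerIndicator (i : Fin 3) :
    piecewiseHarm 0 (cornerIndicator i) = harmBasis i := by
  simp only [piecewiseHarm, harmBasis, cornerIndicator_q]

theorem energyLevel_zero_left (m : ℕ) (u : SG → ℝ) : energyLevel m 0 u = 0 := by
  have := energyLevel_smul_left m 0 0 u
  rwa [zero_smul, zero_mul] at this

/-- The difference quotients in the normal derivative at `q_i` are graph energies. -/
theorem energyLevel_cornerIndicator (k : ℕ) (i : Fin 3) (u : SG → ℝ) :
    energyLevel k (cornerIndicator i) u =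
      (5 / 3) ^ k *
        (2 * u (q i) - u ((Fmap i)^[k] (q (i + 1))) - u ((Fmap i)^[k] (q (i - 1)))) := by
  induction k generalizing u with
  | zero =>
    rw [energyLevel_zero, energyZero_eq]
    simp only [cornerIndicator_q, Function.iterate_zero, id]
    fin_cases i <;> simp [show (-1 : Fin 3) = 2 from rfl, show (2 : Fin 3) - 1 = 1 from rfl,
      show (2 : Fin 3) + 1 = 0 from rfl, show (1 : Fin 3) + 1 = 2 from rfl] <;> ring
  | succ k ih =>
    rw [energyLevel_succ, Finset.sum_eq_single i]
    · rw [cornerIndicator_comp_self, ih, pow_succ', mul_assoc]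
      simp only [Function.comp, Fmap_q_self, Function.iterate_succ_apply']
    · intro j _ hj
      rw [cornerIndicator_comp_of_ne hj, energyLevel_zero_left]
    · simp

/-- The local Gauss-Green formula: the normal derivative of a function `u` with Laplacian `f`
exists at the corners of every cell, and is the difference at the corner, normalized, plus the
integral of `f` against the harmonic function of the cell that is `1` at the corner. The weak
equation is tested with the differences of this harmonic function and its analogues on the cells
`F_w F_i^k SG` that shrink to the corner. -/
theorem HasLaplacian.hasNormalDeriv [IsFiniteMeasure ζ] [NullSingletonClass ζ] {u : SG → ℝ}
    {f : Lp ℝ 2 ζ} (hu : HasLaplacian ζ u f) (w : List (Fin 3)) (i : Fin 3) :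
    HasNormalDeriv u w i ((5 / 3) ^ w.length * (2 * u (Fword w (q i)) - u (Fword w (q (i + 1))) -
      u (Fword w (q (i - 1)))) + ∫ x, f x * cellExtend w (harmBasis i) x ∂ζ) := by
  set e : ℕ → SG → ℝ := fun k => piecewiseHarm k (cornerIndicator i) with he
  have heE : ∀ k, e k ∈ domE := fun k => piecewiseHarm_mem_domE k _
  have he1 : ∀ k x, |e k x| ≤ 1 := fun k => abs_piecewiseHarm_le (abs_cornerIndicator_le i) k
  have hv : ∀ k, e 0 - e k ∈ domE0 := fun k => ⟨sub_mem_domE (heE 0) (heE k), fun j => by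
    simp only [he, Pi.sub_apply, piecewiseHarm_q, sub_self]⟩
  have huw : u ∘ Fword w ∈ domE := comp_Fword_mem_domE hu.1 w
  have hD : ∀ k, energy (u ∘ Fword w) (e k) = energyLevel k (cornerIndicator i) (u ∘ Fword w) :=
    fun k => by rw [energy_comm]; exact energy_piecewiseHarm k _ huw
  have hk : ∀ k, (5 / 3) ^ w.length * energyLevel k (cornerIndicator i) (u ∘ Fword w) =
      (5 / 3) ^ w.length * energyLevel 0 (cornerIndicator i) (u ∘ Fword w) +
        ∫ x, f x * cellExtend w (e 0 - e k) x ∂ζ := by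
    intro k
    have h1 := hu.2 _ (cellExtend_mem_domE0 w (hv k))
    rw [energy_cellExtend w hu.1 (hv k), energy_sub_right huw (heE 0) (heE k), hD, hD] at h1
    linarith
  have hlim : Tendsto (fun k => ∫ x, f x * cellExtend w (e 0 - e k) x ∂ζ) atTop
      (𝓝 (∫ x, f x * cellExtend w (harmBasis i) x ∂ζ)) := by
    have hb : ∀ k x, |cellExtend w (e 0 - e k) x| ≤ 2 := fun k => abs_cellExtend_le w fun x => by
      have := abs_sub (e 0 x) (e k x)
      rw [Pi.sub_apply]
      linarith [he1 0 x, he1 k x]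
    refine tendsto_integral_of_dominated_convergence (fun x => ‖f x‖ * 2) (fun k => ?_) ?_
      (fun k => ?_) ?_
    · exact (integrable_Lp_mul f (measurable_cellExtend w (hv k).1.1.measurable)
        (hb k)).aestronglyMeasurable
    · exact ((Lp.memLp f).integrable one_le_two).norm.mul_const _
    · refine Eventually.of_forall fun x => ?_
      rw [norm_mul]
      exact mul_le_mul_of_nonneg_left (hb k x) (norm_nonneg _)
    · filter_upwards [measure_eq_zero_iff_ae_notMem.1 (measure_singleton (μ := ζ) (Fword w (q i)))]
        with x hx
      refine Tendsto.const_mul _ ?_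
      by_cases hxw : x ∈ Set.range (Fword w)
      · obtain ⟨y, rfl⟩ := hxw
        have hy : y ≠ q i := fun h => hx (by rw [h]; rfl)
        have hnear : cornerIndicator i =ᶠ[𝓝 y] fun _ => 0 := by
          filter_upwards [isOpen_ne.mem_nhds hy] with z hz
          exact if_neg hz
        have h1 := tendsto_piecewiseHarm
          ((continuousAt_const (y := (0 : ℝ))).congr hnear.symm)
        rw [hnear.eq_of_nhds] at h1
        simp only [cellExtend_apply, ← piecewiseHarm_zero_cornerIndicator]
        simpa using h1.const_sub (e 0 y)
      · simp only [cellExtend_of_notMem w _ hxw, tendsto_const_nhds]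
  have hfin := hlim.const_add ((5 / 3) ^ w.length * energyLevel 0 (cornerIndicator i) (u ∘ Fword w))
  simp only [← hk] at hfin
  simp only [energyLevel_cornerIndicator, ← mul_assoc, ← pow_add, add_zero, Function.comp,
    Function.iterate_zero, id] at hfin
  exact hfin

theorem HasLaplacian.hasNormalDeriv_iff [IsFiniteMeasure ζ] [NullSingletonClass ζ] {u : SG → ℝ}
    {f : Lp ℝ 2 ζ} (hu : HasLaplacian ζ u f) (w : List (Fin 3)) (i : Fin 3) (b : ℝ) :
    HasNormalDeriv u w i b ↔ (5 / 3) ^ w.length * (2 * u (Fword w (q i)) -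
      u (Fword w (q (i + 1))) - u (Fword w (q (i - 1)))) +
        ∫ x, f x * cellExtend w (harmBasis i) x ∂ζ = b :=
  ⟨fun h => tendsto_nhds_unique (hu.hasNormalDeriv w i) h, fun h => h ▸ hu.hasNormalDeriv w i⟩

/-- The normal derivative does not change when the cell is replaced by a smaller one. -/
theorem hasNormalDeriv_append_replicate {u : SG → ℝ} {w : List (Fin 3)} {i : Fin 3} {b : ℝ}
    (n : ℕ) :
    HasNormalDeriv u (w ++ List.replicate n i) i b ↔ HasNormalDeriv u w i b := by
  unfold HasNormalDeriv
  rw [← tendsto_add_atTop_iff_nat n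
    (f := fun k : ℕ => (5 / 3 : ℝ) ^ (w.length + k) * (2 * u (Fword w (q i)) -
      u (Fword w ((Fmap i)^[k] (q (i + 1)))) - u (Fword w ((Fmap i)^[k] (q (i - 1))))))]
  refine iff_of_eq (congrArg (Tendsto · atTop (𝓝 b)) (funext fun k => ?_))
  simp only [Fword_append, Function.comp, Fword_replicate_q]
  simp only [Fword_replicate, ← Function.iterate_add_apply, List.length_append,
    List.length_replicate, add_assoc, add_comm k n]

/-! ### Functions with prescribed values and normal derivatives -/

/-- The corner `F_w q_i` given by a word `w` of length `m` and an index `i`. -/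
def corner {m : ℕ} (p : (Fin m → Fin 3) × Fin 3) : SG := Fword (List.ofFn p.1) (q p.2)

/-- The harmonic function of the cell `F_w SG` that is `1` at its corner `F_w q_i` and `0` at the
two other ones, extended by zero. -/
def cellBasis {m : ℕ} (p : (Fin m → Fin 3) × Fin 3) : SG → ℝ :=
  cellExtend (List.ofFn p.1) (harmBasis p.2)

theorem measurable_cellBasis {m : ℕ} (p : (Fin m → Fin 3) × Fin 3) : Measurable (cellBasis p) :=
  measurable_cellExtend _ (continuous_harm _).measurable

theorem abs_cellBasis_le {m : ℕ} (p : (Fin m → Fin 3) × Fin 3) (x : SG) : |cellBasis p x| ≤ 1 :=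
  abs_cellExtend_le _ (abs_harmBasis_le p.2) x

theorem sum_cellBasis {m : ℕ} (c : (Fin m → Fin 3) × Fin 3 → ℝ) (w : Fin m → Fin 3) {y : SG}
    (hy : y ∉ V 0) :
    ∑ p, c p * cellBasis p (Fword (List.ofFn w) y) = harm (fun i => c (w, i)) y := by
  rw [Fintype.sum_prod_type, Finset.sum_eq_single w, harm_apply_eq_sum]
  · simp only [cellBasis, cellExtend_apply]
  · intro w' _ hw
    refine Finset.sum_eq_zero fun i _ => ?_
    rw [cellBasis, cellExtend_of_notMem, mul_zero]
    rintro ⟨z, hz⟩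
    exact hy (mem_V_zero_of_Fword_eq (by simp)
      (fun h => hw (List.ofFn_injective h).symm) hz.symm)
  · simp

theorem exists_ofFn_eq {m : ℕ} (w : List (Fin 3)) (hw : w.length = m) :
    ∃ g : Fin m → Fin 3, List.ofFn g = w := by
  subst hw
  exact ⟨w.get, List.ofFn_get w⟩

theorem mem_V_iff {m : ℕ} {x : SG} : x ∈ V m ↔ ∃ p : (Fin m → Fin 3) × Fin 3, corner p = x := by
  constructor
  · rintro ⟨w, i, hw, rfl⟩
    obtain ⟨g, rfl⟩ := exists_ofFn_eq w hw
    exact ⟨(g, i), rfl⟩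
  · rintro ⟨p, rfl⟩
    exact ⟨_, _, by simp, rfl⟩

/-- Off the null set of the vertices, a piecewise harmonic function is a linear combination of the
harmonic functions of the single cells. -/
theorem piecewiseHarm_eq_sum {m : ℕ} (φ : SG → ℝ) {x : SG} (hx : x ∉ V m) :
    piecewiseHarm m φ x = ∑ p : (Fin m → Fin 3) × Fin 3, φ (corner p) * cellBasis p x := by
  obtain ⟨w, y, hw, rfl⟩ := exists_Fword_eq m x
  have hy : y ∉ V 0 := fun h => by
    obtain ⟨i, rfl⟩ := mem_V_zero.1 h
    exact hx ⟨w, i, hw, rfl⟩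
  obtain ⟨g, rfl⟩ := exists_ofFn_eq w hw
  rw [sum_cellBasis (fun p => φ (corner p)) g hy]
  have := congrFun (piecewiseHarm_comp_Fword φ (List.ofFn g)) y
  rwa [List.length_ofFn] at this

/-- Where a linear combination does not vanish on the interior of a cell, it does not vanish on a
non-empty open set, since the interiors of cells are open and disjoint. -/
theorem eq_zero_of_sum_cellBasis_ae_eq_zero [ζ.IsOpenPosMeasure] {m : ℕ}
    {c : (Fin m → Fin 3) × Fin 3 → ℝ} (h : ∀ᵐ x ∂ζ, ∑ p, c p * cellBasis p x = 0) : c = 0 := by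
  funext ⟨w, i⟩
  suffices (fun i => c (w, i)) = 0 from congrFun this i
  refine eq_zero_of_harm_eq_zero fun x hx => ?_
  by_contra hne
  set U : Set SG := (V 0)ᶜ ∩ {y | harm (fun i => c (w, i)) y ≠ 0}
  have hU : IsOpen U := (finite_V 0).isClosed.isOpen_compl.inter
    (isOpen_ne_fun (continuous_harm _) continuous_const)
  have hU0 : Disjoint U (V 0) := Set.disjoint_left.2 fun y hy => hy.1
  have hnull : ζ (Fword (List.ofFn w) '' U) = 0 := by
    refine measure_mono_null ?_ (ae_iff.1 h)
    rintro _ ⟨y, hy, rfl⟩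
    rw [Set.mem_ofPred_eq, sum_cellBasis c w hy.1]
    exact hy.2
  have hemp := ((isOpen_image_Fword (List.ofFn w) hU hU0).1.measure_eq_zero_iff ζ).1 hnull
  exact Set.notMem_empty _ (hemp ▸ Set.mem_image_of_mem _ (show x ∈ U from ⟨hx, hne⟩))

/-- The moments of an `L²` function against the harmonic functions of the single cells can be
prescribed, because these functions are linearly independent in `L²(ζ)`. -/
theorem exists_moments_eq [IsFiniteMeasure ζ] [ζ.IsOpenPosMeasure] {m : ℕ}
    (c : (Fin m → Fin 3) × Fin 3 → ℝ) :
    ∃ f : Lp ℝ 2 ζ, ∀ p, ∫ x, f x * cellBasis p x ∂ζ = c p := by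
  have hmem : ∀ p : (Fin m → Fin 3) × Fin 3, MemLp (cellBasis p) 2 ζ := fun p =>
    memLp_of_abs_le (measurable_cellBasis p) (abs_cellBasis_le p)
  let Φ : Lp ℝ 2 ζ →ₗ[ℝ] ((Fin m → Fin 3) × Fin 3 → ℝ) :=
    LinearMap.pi fun p => (innerSL ℝ (hmem p).toLp).toLinearMap
  have hΦ : ∀ f p, Φ f p = inner ℝ (hmem p).toLp f := fun f p => rfl
  have hsurj : Function.Surjective Φ := by
    rw [← LinearMap.dualMap_injective_iff, ← LinearMap.ker_eq_bot, LinearMap.ker_eq_bot']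
    intro d hd
    set k : (Fin m → Fin 3) × Fin 3 → ℝ := fun p => d (Pi.single p 1) with hk
    have hdk : ∀ z, d z = ∑ p, k p * z p := by
      intro z
      rw [LinearMap.pi_apply_eq_sum_univ d z]
      refine Finset.sum_congr rfl fun p _ => ?_
      rw [smul_eq_mul, mul_comm, hk]
      congr 2
      funext j
      simp [Pi.single_apply, eq_comm]
    have hS : ∑ p, k p • (hmem p).toLp = 0 := by
      refine ext_inner_right ℝ fun f => ?_
      have h1 : d (Φ f) = 0 := LinearMap.congr_fun hd f
      rw [hdk] at h1
      simpa only [sum_inner, real_inner_smul_left, inner_zero_left, hΦ] using h1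
    have hk0 : k = 0 := by
      refine eq_zero_of_sum_cellBasis_ae_eq_zero (ζ := ζ) ?_
      have h1 := Lp.coeFn_fun_finsetSum Finset.univ fun p => k p • (hmem p).toLp
      rw [hS] at h1
      filter_upwards [h1, Lp.coeFn_zero ℝ 2 ζ,
        ae_all_iff.2 fun p => Lp.coeFn_smul (k p) (hmem p).toLp,
        ae_all_iff.2 fun p => (hmem p).coeFn_toLp] with x h1 h2 h3 h4
      rw [h2] at h1
      simpa only [h3, h4, Pi.smul_apply, smul_eq_mul, Pi.zero_apply] using h1.symm
    refine LinearMap.ext fun z => ?_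
    rw [hdk, hk0]
    simp
  obtain ⟨f, hf⟩ := hsurj c
  refine ⟨f, fun p => ?_⟩
  rw [← inner_toLp f (hmem p), real_inner_comm, ← hΦ, hf]

theorem energyLevel_eq_sum_corner (m : ℕ) (u v : SG → ℝ) :
    energyLevel m u v = ∑ p : (Fin m → Fin 3) × Fin 3, v (corner p) *
      ((5 / 3) ^ m *
        (2 * u (corner p) - u (corner (p.1, p.2 + 1)) - u (corner (p.1, p.2 - 1)))) := by
  rw [energyLevel, Fintype.sum_prod_type, Finset.mul_sum]
  refine Finset.sum_congr rfl fun w _ => ?_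
  simp only [energyZero_eq, corner, Function.comp, Fin.sum_univ_three,
    show (0 : Fin 3) - 1 = 2 from rfl, show (2 : Fin 3) - 1 = 1 from rfl,
    show (2 : Fin 3) + 1 = 0 from rfl, show (1 : Fin 3) + 1 = 2 from rfl,
    show (0 : Fin 3) + 1 = 1 from rfl, show (1 : Fin 3) - 1 = 0 from rfl]
  ring

/-- A right-hand side with the moments that the local Gauss-Green formula asks for: the solution of
the Dirichlet problem then has the values `a` on `V_m`, because its difference to `a` has graph
energy zero, by the weak equation for the piecewise harmonic function equal to this difference on
`V_m`. The condition on `d` says that at every vertex outside `V_0` the normal derivatives add up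
to zero. -/
theorem exists_hasLaplacian_of_sum_eq_zero [IsFiniteMeasure ζ] [NullSingletonClass ζ]
    [ζ.IsOpenPosMeasure] {m : ℕ} (a : SG → ℝ) (d : (Fin m → Fin 3) × Fin 3 → ℝ)
    (hd : ∀ φ : SG → ℝ, (∀ i, φ (q i) = 0) → ∑ p, φ (corner p) * d p = 0) :
    ∃ (u : SG → ℝ) (f : Lp ℝ 2 ζ), HasLaplacian ζ u f ∧ (∀ x ∈ V m, u x = a x) ∧
      ∀ p : (Fin m → Fin 3) × Fin 3, HasNormalDeriv u (List.ofFn p.1) p.2 (d p) := by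
  obtain ⟨f, hf⟩ := exists_moments_eq (ζ := ζ) (m := m) fun p => d p -
    (5 / 3) ^ m * (2 * a (corner p) - a (corner (p.1, p.2 + 1)) - a (corner (p.1, p.2 - 1)))
  set u := harm (fun i => a (q i)) + (greenOperator ζ f).toFun with hu
  have hL : HasLaplacian ζ u f := hasLaplacian_harm_add_green _ f
  have huq : ∀ i, (u - a) (q i) = 0 := fun i => by
    rw [hu, Pi.sub_apply, Pi.add_apply, harm_q, (greenOperator ζ f).mem.2]
    ring
  have h1 := hL.2 _ (piecewiseHarm_mem_domE0 m huq)
  have h2 : ∫ x, f x * piecewiseHarm m (u - a) x ∂ζ = -energyLevel m a (u - a) := by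
    calc ∫ x, f x * piecewiseHarm m (u - a) x ∂ζ
        = ∫ x, ∑ p : (Fin m → Fin 3) × Fin 3,
            (u - a) (corner p) * (f x * cellBasis p x) ∂ζ := by
          refine integral_congr_ae ?_
          filter_upwards [measure_eq_zero_iff_ae_notMem.1 (measure_V (ζ := ζ) m)] with x hx
          rw [piecewiseHarm_eq_sum _ hx, Finset.mul_sum]
          exact Finset.sum_congr rfl fun p _ => by ring
      _ = ∑ p : (Fin m → Fin 3) × Fin 3,
            (u - a) (corner p) * ∫ x, f x * cellBasis p x ∂ζ := by
          rw [integral_finsetSum _ fun p _ => (integrable_Lp_mul f (measurable_cellBasis p)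
            (abs_cellBasis_le p)).const_mul _]
          simp only [integral_const_mul]
      _ = -energyLevel m a (u - a) := by
          rw [energyLevel_eq_sum_corner, ← zero_sub (Finset.sum _ _), ← hd _ huq,
            ← Finset.sum_sub_distrib]
          exact Finset.sum_congr rfl fun p _ => by rw [hf, mul_sub]
  have h3 : energyLevel m (u - a) (u - a) = 0 := by
    rw [energy_comm, energy_piecewiseHarm m _ hL.1, h2, neg_neg, energyLevel_comm] at h1
    rw [sub_eq_add_neg, ← neg_one_smul ℝ a, energyLevel_add_left, energyLevel_smul_left,
      neg_one_smul, ← sub_eq_add_neg, h1]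
    ring
  have h4 : piecewiseHarm m (u - a) = 0 := by
    refine eq_zero_of_energy_eq_zero (piecewiseHarm_mem_domE0 m huq) ?_
    have h5 := energyLevel_add_piecewiseHarm m 0 (u - a) (u - a)
    rw [add_zero] at h5
    rw [energy_piecewiseHarm m _ (piecewiseHarm_mem_domE m _), energyLevel_comm, h5, h3]
  have hua : ∀ x ∈ V m, u x = a x := by
    rintro x ⟨w, i, rfl, rfl⟩
    have := piecewiseHarm_Fword_q (u - a) w i
    rw [h4] at this
    exact sub_eq_zero.1 this.symm
  refine ⟨u, f, hL, hua, fun p => (hL.hasNormalDeriv_iff _ _ _).2 ?_⟩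
  have hc : ∀ p : (Fin m → Fin 3) × Fin 3, u (corner p) = a (corner p) := fun p =>
    hua _ (mem_V_iff.2 ⟨p, rfl⟩)
  have hp := hf p
  simp only [← hc] at hp
  rw [List.length_ofFn]
  simp only [corner, cellBasis] at hp
  rw [hp]
  ring

/-- A normal derivative prescribed at a vertex outside `V_0` is balanced by its negative at a
second corner at the same point. -/
theorem exists_balanced_family {m : ℕ} (F : Finset SG) (b : SG → ℝ)
    (p : SG → (Fin m → Fin 3) × Fin 3) (hp : ∀ y ∈ F, corner (p y) = y) :
    ∃ d : (Fin m → Fin 3) × Fin 3 → ℝ, (∀ y ∈ F, d (p y) = b y) ∧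
      ∀ φ : SG → ℝ, (∀ i, φ (q i) = 0) → ∑ s, φ (corner s) * d s = 0 := by
  classical
  have hp' : ∀ y, ∃ s : (Fin m → Fin 3) × Fin 3, y ∈ F → y ∉ V 0 → s ≠ p y ∧ corner s = y := by
    intro y
    by_cases hy : y ∈ F ∧ y ∉ V 0
    · have h0 : Fword (List.ofFn (p y).1) (q (p y).2) ∉ V 0 := by
        rw [show Fword (List.ofFn (p y).1) (q (p y).2) = y from hp y hy.1]
        exact hy.2
      obtain ⟨w, i, hl, hne, he⟩ := exists_other_corner _ _ h0
      obtain ⟨g, rfl⟩ := exists_ofFn_eq (m := m) w (by simpa using hl)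
      refine ⟨(g, i), fun _ _ => ⟨fun h => hne ?_, he.trans (hp y hy.1)⟩⟩
      rw [← h]
    · exact ⟨p y, fun h1 h2 => absurd ⟨h1, h2⟩ hy⟩
  choose p' hp' using hp'
  refine ⟨fun s => ∑ y ∈ F, b y * ((if s = p y then 1 else 0) -
    if y ∉ V 0 ∧ s = p' y then 1 else 0), fun y hy => ?_, fun φ hφ => ?_⟩
  · beta_reduce
    rw [Finset.sum_eq_single_of_mem y hy, if_pos rfl, if_neg, sub_zero, mul_one]
    · rintro ⟨h1, h2⟩
      exact (hp' y hy h1).1 h2.symm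
    · intro z hz hzy
      rw [if_neg, if_neg, sub_zero, mul_zero]
      · rintro ⟨h1, h2⟩
        apply hzy
        rw [← hp y hy, h2, (hp' z hz h1).2]
      · intro h
        apply hzy
        rw [← hp y hy, h, hp z hz]
  · simp only [Finset.mul_sum]
    rw [Finset.sum_comm]
    refine Finset.sum_eq_zero fun y hy => ?_
    have h1 : ∑ s, φ (corner s) * (b y * ((if s = p y then 1 else 0) -
        if y ∉ V 0 ∧ s = p' y then 1 else 0)) =
        b y * (φ (corner (p y)) - if y ∉ V 0 then φ (corner (p' y)) else 0) := by
      simp only [mul_left_comm _ (b y), ← Finset.mul_sum, mul_sub, Finset.sum_sub_distrib]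
      by_cases h0 : y ∈ V 0 <;> simp [h0]
    rw [h1, hp y hy]
    by_cases h0 : y ∈ V 0
    · obtain ⟨i, rfl⟩ := mem_V_zero.1 h0
      rw [if_neg (not_not.2 h0), hφ, sub_zero, mul_zero]
    · rw [if_pos h0, (hp' y hy h0).2, sub_self, mul_zero]

/-- Values and normal derivatives at finitely many vertices can be prescribed: all the data live on
one level `n`. -/
theorem admissible_nonempty [IsFiniteMeasure ζ] [NullSingletonClass ζ] [ζ.IsOpenPosMeasure]
    (m : ℕ) {E F : Finset SG} (hE : ∀ x ∈ E, x ∈ V m) (a b : SG → ℝ) {w : SG → List (Fin 3)}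
    {i : SG → Fin 3} (hcell : ∀ y ∈ F, Fword (w y) (q (i y)) = y) :
    (admissible ζ E F a b w i).Nonempty := by
  set n := m + ∑ y ∈ F, (w y).length with hn
  have hw : ∀ y ∈ F, (w y).length ≤ n := fun y hy =>
    (Finset.single_le_sum (f := fun y => (w y).length) (fun _ _ => Nat.zero_le _) hy).trans
      (Nat.le_add_left _ _)
  have hg : ∀ y, ∃ g : Fin n → Fin 3, y ∈ F →
      List.ofFn g = w y ++ List.replicate (n - (w y).length) (i y) := by
    intro y
    by_cases hy : y ∈ F
    · obtain ⟨g, hg⟩ := exists_ofFn_eq (m := n) (w y ++ List.replicate (n - (w y).length) (i y))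
        (by have := hw y hy; simp; omega)
      exact ⟨g, fun _ => hg⟩
    · exact ⟨fun _ => 0, fun h => absurd h hy⟩
  choose g hg using hg
  obtain ⟨d, hdb, hd⟩ := exists_balanced_family F b (fun y => (g y, i y)) fun y hy => by
    rw [corner, hg y hy, Fword_append, Function.comp, Fword_replicate_q, hcell y hy]
  obtain ⟨u, f, hL, hua, hud⟩ := exists_hasLaplacian_of_sum_eq_zero (ζ := ζ) a d hd
  refine ⟨u, ⟨f, hL⟩, fun x hx => hua x (V_mono (Nat.le_add_right _ _) (hE x hx)), fun y hy => ?_⟩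
  have h := hud (g y, i y)
  rw [hdb y hy] at h
  simp only [hg y hy] at h
  exact (hasNormalDeriv_append_replicate _).1 h

/-! ### The minimization problem -/

theorem HasNormalDeriv.add {u v : SG → ℝ} {w : List (Fin 3)} {i : Fin 3} {b c : ℝ}
    (hu : HasNormalDeriv u w i b) (hv : HasNormalDeriv v w i c) :
    HasNormalDeriv (u + v) w i (b + c) := by
  refine (Tendsto.add hu hv).congr fun k => ?_
  simp only [Pi.add_apply]
  ring

theorem HasNormalDeriv.smul (s : ℝ) {u : SG → ℝ} {w : List (Fin 3)} {i : Fin 3} {b : ℝ}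
    (hu : HasNormalDeriv u w i b) : HasNormalDeriv (s • u) w i (s * b) := by
  refine (Tendsto.const_mul s hu).congr fun k => ?_
  simp only [Pi.smul_apply, smul_eq_mul]
  ring

variable (ζ) in
/-- The Laplacians of the admissible functions. -/
def admissibleLaplacians (E F : Finset SG) (a b : SG → ℝ) (w : SG → List (Fin 3))
    (i : SG → Fin 3) : Set (Lp ℝ 2 ζ) :=
  {f | ∃ u ∈ admissible ζ E F a b w i, HasLaplacian ζ u f}

theorem convex_admissibleLaplacians [IsFiniteMeasure ζ] (E F : Finset SG) (a b : SG → ℝ)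
    (w : SG → List (Fin 3)) (i : SG → Fin 3) :
    Convex ℝ (admissibleLaplacians ζ E F a b w i) := by
  rintro f ⟨u, ⟨-, hua, hub⟩, hf⟩ g ⟨v, ⟨-, hva, hvb⟩, hg⟩ s t - - hst
  have hL := (hf.smul s).add (hg.smul t)
  refine ⟨s • u + t • v, ⟨⟨_, hL⟩, fun x hx => ?_, fun y hy => ?_⟩, hL⟩
  · rw [Pi.add_apply, Pi.smul_apply, Pi.smul_apply, hua x hx, hva x hx, ← add_smul, hst, one_smul]
  · have := ((hub y hy).smul s).add ((hvb y hy).smul t)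
    rwa [← add_mul, hst, one_mul] at this

/-- A function is determined by its Laplacian and its values at three points at which the values
of the harmonic functions form an invertible matrix. -/
theorem HasLaplacian.eq_of_eq_on {u v : SG → ℝ} {f : Lp ℝ 2 ζ} (hu : HasLaplacian ζ u f)
    (hv : HasLaplacian ζ v f) {x : Fin 3 → SG}
    (hx : IsUnit (Matrix.of fun k j => harmBasis j (x k))) (huv : ∀ k, u (x k) = v (x k)) :
    u = v := by
  have h1 := hu.sub_eq_harm hv
  set c : Fin 3 → ℝ := fun i => (u - v) (q i)
  have h2 : (Matrix.of fun k j => harmBasis j (x k)).mulVec c = 0 := by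
    funext k
    have h3 := congrFun h1 (x k)
    rw [Pi.sub_apply, huv, sub_self, harm_apply_eq_sum] at h3
    simp only [Matrix.mulVec, dotProduct, Matrix.of_apply, Pi.zero_apply]
    rw [h3]
    exact Finset.sum_congr rfl fun j _ => mul_comm _ _
  have h3 : c = 0 := Matrix.mulVec_injective_of_isUnit hx (h2.trans (Matrix.mulVec_zero _).symm)
  rw [h3, ← zero_smul ℝ 0, harm_smul, zero_smul] at h1
  exact sub_eq_zero.1 h1

/-- For every `f` there is exactly one function with Laplacian `f` and the prescribed values at
three nondegenerate points. Its values depend continuously on `f`, and so do its normal derivatives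
by the local Gauss-Green formula; the remaining constraints are therefore closed conditions on
`f`. -/
theorem isClosed_admissibleLaplacians [IsFiniteMeasure ζ] [NullSingletonClass ζ]
    {E F : Finset SG} {a b : SG → ℝ} {w : SG → List (Fin 3)} {i : SG → Fin 3} {x : Fin 3 → SG}
    (hxE : ∀ k, x k ∈ E) (hx : IsUnit (Matrix.of fun k j => harmBasis j (x k))) :
    IsClosed (admissibleLaplacians ζ E F a b w i) := by
  set N : Matrix (Fin 3) (Fin 3) ℝ := Matrix.of fun k j => harmBasis j (x k) with hN
  set α : Lp ℝ 2 ζ → Fin 3 → ℝ := fun f =>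
    N⁻¹.mulVec fun k => a (x k) - (greenOperator ζ f).toFun (x k) with hα
  set U : Lp ℝ 2 ζ → SG → ℝ := fun f => harm (α f) + (greenOperator ζ f).toFun with hU
  have hL : ∀ f, HasLaplacian ζ (U f) f := fun f => hasLaplacian_harm_add_green _ f
  have hUx : ∀ f k, U f (x k) = a (x k) := by
    intro f k
    have h1 : N.mulVec (α f) = fun k => a (x k) - (greenOperator ζ f).toFun (x k) := by
      rw [hα, Matrix.mulVec_mulVec,
        Matrix.mul_nonsing_inv _ ((Matrix.isUnit_iff_isUnit_det _).1 hx), Matrix.one_mulVec]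
    have h2 : harm (α f) (x k) = a (x k) - (greenOperator ζ f).toFun (x k) := by
      rw [← congrFun h1 k, harm_apply_eq_sum]
      exact Finset.sum_congr rfl fun j _ => mul_comm _ _
    simp only [hU, Pi.add_apply]
    rw [h2, sub_add_cancel]
  have hUc : ∀ z, Continuous fun f => U f z := by
    intro z
    have hαc : Continuous α := continuous_const.matrix_mulVec
      (continuous_pi fun k => continuous_const.sub (continuous_greenOperator_apply (x k)))
    simp only [hU, Pi.add_apply, harm_apply_eq_sum]
    exact (continuous_finsetSum _ fun j _ => ((continuous_apply j).comp hαc).mul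
      continuous_const).add (continuous_greenOperator_apply z)
  have hC : admissibleLaplacians ζ E F a b w i = (⋂ z ∈ E, {f | U f z = a z}) ∩
      ⋂ y ∈ F, {f | (5 / 3) ^ (w y).length * (2 * U f (Fword (w y) (q (i y))) -
        U f (Fword (w y) (q (i y + 1))) - U f (Fword (w y) (q (i y - 1)))) +
          ∫ x, f x * cellExtend (w y) (harmBasis (i y)) x ∂ζ = b y} := by
    ext f
    simp only [Set.mem_inter_iff, Set.mem_iInter, Set.mem_ofPred_eq,
      ← (hL f).hasNormalDeriv_iff]
    constructor
    · rintro ⟨u, ⟨-, hua, hub⟩, hu⟩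
      have huU : u = U f := hu.eq_of_eq_on (hL f) hx fun k => by rw [hUx, hua _ (hxE k)]
      exact huU ▸ ⟨hua, hub⟩
    · rintro ⟨h1, h2⟩
      exact ⟨U f, ⟨⟨f, hL f⟩, h1, h2⟩, hL f⟩
  rw [hC]
  refine (isClosed_biInter fun z _ => isClosed_eq (hUc z) continuous_const).inter
    (isClosed_biInter fun y _ => isClosed_eq (Continuous.add ?_ ?_) continuous_const)
  · exact continuous_const.mul (((continuous_const.mul (hUc _)).sub (hUc _)).sub (hUc _))
  · have hmem : MemLp (cellExtend (w y) (harmBasis (i y))) 2 ζ :=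
      memLp_of_abs_le (measurable_cellExtend _ (continuous_harm _).measurable)
        (abs_cellExtend_le _ (abs_harmBasis_le _))
    simp only [← inner_toLp _ hmem]
    exact continuous_id.inner continuous_const

end

end SierpinskiGasket

open SierpinskiGasket
theorem mainTheorem8 (ζ : Measure SG) [IsFiniteMeasure ζ] [NullSingletonClass ζ] [ζ.IsOpenPosMeasure]
    (hζ : LaplacianCellBound ζ) (m : ℕ) (E F : Finset SG)
    (hE : ∀ x ∈ E, x ∈ V m) (hF : ∀ y ∈ F, y ∈ V m) (hH : HarmonicallyNondegenerate E)
    (a b : SG → ℝ) (w : SG → List (Fin 3)) (i : SG → Fin 3)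
    (hcell : ∀ y ∈ F, Fword (w y) (q (i y)) = y) :
    ∃! u : SG → ℝ, u ∈ admissible ζ E F a b w i ∧
      ∀ v ∈ admissible ζ E F a b w i, T ζ u ≤ T ζ v := by
  obtain ⟨h, hh, x, hxE, hx⟩ := hH
  have hbasis : ∀ j, h j = harmBasis j := fun j => by
    rw [(hh j).1.eq_harm, harmBasis]
    simp only [(hh j).2]
  simp only [hbasis] at hx
  set K := admissibleLaplacians ζ E F a b w i with hK
  have hne : K.Nonempty := by
    obtain ⟨u, hu⟩ := admissible_nonempty (ζ := ζ) m hE a b hcell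
    obtain ⟨f, hf⟩ := hu.1
    exact ⟨f, u, hu, hf⟩
  have hconv : Convex ℝ K := convex_admissibleLaplacians E F a b w i
  obtain ⟨f, hfK, hmin⟩ := exists_norm_eq_iInf_of_complete_convex hne
    (isClosed_admissibleLaplacians hxE hx).isComplete hconv 0
  -- The variational inequality at the element of least norm gives more than minimality.
  have hpyth : ∀ g ∈ K, ‖f‖ ^ 2 + ‖g - f‖ ^ 2 ≤ ‖g‖ ^ 2 := by
    intro g hg
    have h1 := (norm_eq_iInf_iff_real_inner_le_zero hconv hfK).1 hmin g hg
    rw [zero_sub, inner_neg_left] at h1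
    have h2 := norm_add_sq_real f (g - f)
    rw [add_sub_cancel] at h2
    linarith
  obtain ⟨u, hu, hf⟩ := id hfK
  refine ⟨u, ⟨hu, fun v hv => ?_⟩, ?_⟩
  · obtain ⟨g, hg⟩ := hv.1
    rw [T_eq_norm_sq hf, T_eq_norm_sq hg]
    linarith [hpyth g ⟨v, hv, hg⟩, sq_nonneg ‖g - f‖]
  · rintro v ⟨hv, hvmin⟩
    obtain ⟨g, hg⟩ := hv.1
    have h1 := hvmin u hu
    rw [T_eq_norm_sq hf, T_eq_norm_sq hg] at h1
    have h2 : g = f := by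
      have h3 : ‖g - f‖ ^ 2 ≤ 0 := by linarith [hpyth g ⟨v, hv, hg⟩]
      exact sub_eq_zero.1 (norm_eq_zero.1 (pow_eq_zero_iff two_ne_zero |>.1
        (le_antisymm h3 (sq_nonneg _))))
    subst h2
    exact hg.eq_of_eq_on hf hx fun k => by rw [hv.2.1 _ (hxE k), hu.2.1 _ (hxE k)]
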